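/- Let $n\in\{2,3\}$ and let $\Omega\subset\mathbb R^n$ be a bounded, simply connected (possibly curvilinear) polytopal domain with Lipschitz boundary $\Gamma=\partial\Omega$, such that the geodesic distance on $\Gamma$ is bounded by a constant times the Euclidean distance. Put $$\|v\|_{1/2,\Gamma}^2=\|v\|_{L^2(\Gamma)}^2+|v|_{1/2,\Gamma}^2,\qquad |v|_{1/2,\Gamma}^2=\int_\Gamma\int_\Gamma\frac{|v(t)-v(s)|^2}{|t-s|^n}\,ds\,dt ,$$ let $H^{1/2}(\Gamma)$ be the space of $v\in L^2(\Gamma)$ with $\|v\|_{1/2,\Gamma}<\infty$, and let $H^{-1/2}(\Gamma)$ be its dual, with the dual norm $\|\cdot\|_{-1/2,\Gamma}$. For $\omega\subseteq\Gamma$ let $H^{1/2}_{00}(\omega)$ be the space of functions on $\omega$ whose extension by zero belongs to $H^{1/2}(\Gamma)$ (functions are identified with their extensions), and for $\zeta\in H^{-1/2}(\Gamma)$ let $$\|\zeta\|_{\widetilde H^{-1/2}(\omega)}=\sup_{v\in H^{1/2}_{00}(\omega)}\frac{\langle\zeta,v\rangle}{|v|_{1/2,\Gamma}}\in[0,\infty]\qquad(0/0=0).$$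 Let $\mathcal T_h$ be a shape regular, quasi-uniform decomposition of $\Gamma$, of mesh size $h$, into finitely many non-overlapping (possibly curvilinear) segments ($n=2$) or triangles ($n=3$): each element $T$ has a parametrization over the reference simplex which, after division by $\operatorname{diam}T$, is bi-Lipschitz with constant $\kappa$, and $h=\max_T\operatorname{diam}T\le\kappa\operatorname{diam}T$ for all $T$. Let $\mathcal N$ be the set of its nodes (the vertices of its elements) and, for $y\in\mathcal N$, let $\omega_y=\bigcup\{T\in\mathcal T_h: y\in\partial T\}$. Let $\widetilde\Pi:H^{-1/2}(\Gamma)\to H^{-1/2}(\Gamma)$ be a bounded linear projector with $\|\widetilde\Pi\|\le M$, and assume that there are functions $\phi^y\in W^{1,\infty}_0(\omega_y)$, $y\in\mathcal N$, extended by zero to $\Gamma$, with $$\sum_{y\in\mathcal N}\phi^y=1\ \text{ on }\Gamma,\qquad \|\phi^y\|_{0,\infty,\omega_y}\le c,\qquad |\phi^y|_{1,\infty,\omega_y}\le c\,h^{-1},$$ such that $\langle\zeta-\widetilde\Pi\zeta,\phi^y\rangle=0$ for all $\zeta\in H^{-1/2}(\Gamma)$ and all $y\in\mathcal N$. (Here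 $|\phi^y|_{1,\infty,\omega_y}$ is the Lipschitz constant, with respect to the geodesic distance on $\Gamma$, of the extension of $\phi^y$.) Then, for all $\zeta\in H^{-1/2}(\Gamma)$, $$C^{-1}\|\zeta\|_{-1/2,\Gamma}^2\le\|\widetilde\Pi\zeta\|_{-1/2,\Gamma}^2+\sum_{y\in\mathcal N}\|\zeta-\widetilde\Pi\zeta\|_{\widetilde H^{-1/2}(\omega_y)}^2\le C\,\|\zeta\|_{-1/2,\Gamma}^2 ,$$ with a constant $C>0$ that depends only on $\Omega$, $\kappa$, $c$ and $M$, and in particular not on the mesh size $h$. -/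

import Mathlib

open MeasureTheory Set
open scoped ENNReal NNReal

noncomputable section

namespace TraceNorm

/-! ### The boundary of the domain -/

/-- Euclidean space `ℝᵏ`. -/
abbrev E (k : ℕ) : Type := EuclideanSpace ℝ (Fin k)

/-- The (intrinsic) geodesic distance on `Γ`: the infimum of the lengths of the continuous curves
in `Γ` that join the two points (`∞` if there is none). -/
def geodesicEDist {k : ℕ} (Γ : Set (E k)) (s t : E k) : ℝ≥0∞ :=
  ⨅ γ : {γ : ℝ → E k // ContinuousOn γ (Icc 0 1) ∧ MapsTo γ (Icc 0 1) Γ ∧ γ 0 = s ∧ γ 1 = t},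
    eVariationOn γ.1 (Icc 0 1)

/-- Near each of its boundary points, `Ω` is, in suitable Cartesian coordinates, the region
strictly below the graph of a Lipschitz function. -/
def HasLipschitzBoundary {d : ℕ} (Ω : Set (E (d + 1))) : Prop :=
  ∀ x ∈ frontier Ω, ∃ r > 0, ∃ e : E (d + 1) ≃ᵢ WithLp 2 (E d × ℝ), ∃ g : E d → ℝ, ∃ L : ℝ≥0,
    LipschitzWith L g ∧ ∀ z ∈ Metric.ball x r, z ∈ Ω ↔ (e z).snd < g (e z).fst

/-- The standing assumptions on the domain `Ω ⊆ ℝⁿ`, `n = d + 1`. (That `Ω` is a curvilinear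
polytope is expressed by the existence of the meshes of `∂Ω` considered below.) -/
structure IsAdmissibleDomain {d : ℕ} (Ω : Set (E (d + 1))) : Prop where
  isOpen : IsOpen Ω
  isBounded : Bornology.IsBounded Ω
  simplyConnected : IsSimplyConnected Ω
  lipschitz : HasLipschitzBoundary Ω
  nondegenerate : ∃ K : ℝ≥0, ∀ s ∈ frontier Ω, ∀ t ∈ frontier Ω,
    geodesicEDist (frontier Ω) s t ≤ K * edist s t

/-- The surface measure on `Γ ⊆ ℝᵈ⁺¹`: `d`-dimensional Hausdorff measure restricted to `Γ`. -/
def surf {d : ℕ} (Γ : Set (E (d + 1))) : Measure (E (d + 1)) := (μHE[d]).restrict Γ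

/-! ### The space `H^{1/2}(Γ)` and its dual

Functions on `Γ` are represented by functions on the ambient space; only their values on `Γ`
matter. -/

section Half

variable {d : ℕ} (Γ : Set (E (d + 1)))

/-- `(v(t) - v(s)) / |t - s|^{n/2}`, with `n = d + 1`. -/
def diffQuot (v : E (d + 1) → ℝ) (p : E (d + 1) × E (d + 1)) : ℝ :=
  (v p.1 - v p.2) / √(dist p.1 p.2 ^ (d + 1))

theorem diffQuot_add (v w : E (d + 1) → ℝ) :
    diffQuot (v + w) = diffQuot v + diffQuot w := by
  funext p; simp only [diffQuot, Pi.add_apply]; ring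

theorem diffQuot_smul (c : ℝ) (v : E (d + 1) → ℝ) :
    diffQuot (c • v) = c • diffQuot v := by
  funext p; simp only [diffQuot, Pi.smul_apply, smul_eq_mul]; ring

theorem diffQuot_sq (v : E (d + 1) → ℝ) (p : E (d + 1) × E (d + 1)) :
    diffQuot v p ^ 2 = |v p.1 - v p.2| ^ 2 / dist p.1 p.2 ^ (d + 1) := by
  rw [diffQuot, div_pow, Real.sq_sqrt (by positivity), sq_abs]

/-- The functions `v ∈ L²(Γ)` with `∬ |v(t) - v(s)|² / |t - s|ⁿ < ∞`. -/
def HhalfSub : Submodule ℝ (E (d + 1) → ℝ) where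
  carrier := {v | MemLp v 2 (surf Γ) ∧ MemLp (diffQuot v) 2 ((surf Γ).prod (surf Γ))}
  zero_mem' := by
    have : diffQuot (0 : E (d + 1) → ℝ) = 0 := by funext p; simp [diffQuot]
    exact ⟨MemLp.zero, by rw [this]; exact MemLp.zero⟩
  add_mem' := fun {v w} hv hw => ⟨hv.1.add hw.1, by rw [diffQuot_add]; exact hv.2.add hw.2⟩
  smul_mem' := fun c v hv =>
    ⟨hv.1.const_smul c, by rw [diffQuot_smul]; exact hv.2.const_smul c⟩

/-- The space `H^{1/2}(Γ)`. As a seminormed space of functions: functions that agree almost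
everywhere on `Γ` are at distance zero rather than identified, which does not change the dual. -/
def Hhalf : Type := HhalfSub Γ

instance : AddCommGroup (Hhalf Γ) := inferInstanceAs (AddCommGroup (HhalfSub Γ))

instance : Module ℝ (Hhalf Γ) := inferInstanceAs (Module ℝ (HhalfSub Γ))

variable {Γ}

instance : CoeFun (Hhalf Γ) (fun _ => E (d + 1) → ℝ) := ⟨fun v => v.1⟩

/-- `‖v‖²_{0,Γ} = ∫_Γ |v|²`. -/
def l2Sq (v : Hhalf Γ) : ℝ := ∫ s, |v s| ^ 2 ∂(surf Γ)

/-- `|v|²_{1/2,Γ} = ∫_Γ ∫_Γ |v(t) - v(s)|² / |t - s|ⁿ`, with `n = d + 1`. -/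
def semiSq (v : Hhalf Γ) : ℝ :=
  ∫ p, |v p.1 - v p.2| ^ 2 / dist p.1 p.2 ^ (d + 1) ∂((surf Γ).prod (surf Γ))

instance : Norm (Hhalf Γ) := ⟨fun v => √(l2Sq v + semiSq v)⟩

theorem Hhalf.norm_def (v : Hhalf Γ) : ‖v‖ = √(l2Sq v + semiSq v) := rfl

/-- The linear map `v ↦ (v, diffQuot v)`, used to check that `‖·‖` is a seminorm. -/
def Hhalf.graphMap : Hhalf Γ →ₗ[ℝ]
    WithLp 2 (Lp ℝ 2 (surf Γ) × Lp ℝ 2 ((surf Γ).prod (surf Γ))) where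
  toFun v := WithLp.toLp 2 (v.2.1.toLp v.1, v.2.2.toLp (diffQuot v.1))
  map_add' v w := by
    apply (WithLp.equiv 2 _).injective
    refine Prod.ext ?_ ?_
    · exact MemLp.toLp_add v.2.1 w.2.1
    · have h : ((v + w : Hhalf Γ).2.2).toLp (diffQuot (v + w).1)
          = (v.2.2.add w.2.2).toLp (diffQuot v.1 + diffQuot w.1) :=
        MemLp.toLp_congr _ _ (Filter.EventuallyEq.of_eq (diffQuot_add v.1 w.1))
      exact h.trans (MemLp.toLp_add v.2.2 w.2.2)
  map_smul' c v := by
    apply (WithLp.equiv 2 _).injective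
    refine Prod.ext ?_ ?_
    · exact MemLp.toLp_const_smul c v.2.1
    · have h : ((c • v : Hhalf Γ).2.2).toLp (diffQuot (c • v).1)
          = (v.2.2.const_smul c).toLp (c • diffQuot v.1) :=
        MemLp.toLp_congr _ _ (Filter.EventuallyEq.of_eq (diffQuot_smul c v.1))
      exact h.trans (MemLp.toLp_const_smul c v.2.2)

theorem norm_toLp_sq {α : Type*} [MeasurableSpace α] {μ : Measure α} {f : α → ℝ}
    (hf : MemLp f 2 μ) : ‖hf.toLp f‖ ^ 2 = ∫ x, f x ^ 2 ∂μ := by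
  rw [← real_inner_self_eq_norm_sq, L2.inner_def]
  refine integral_congr_ae ?_
  filter_upwards [hf.coeFn_toLp] with x hx
  simp [hx, sq]

theorem Hhalf.norm_eq (v : Hhalf Γ) : ‖v‖ = ‖Hhalf.graphMap v‖ := by
  rw [Hhalf.norm_def, WithLp.prod_norm_eq_of_L2]
  congr 2
  · refine Eq.trans ?_ (norm_toLp_sq v.2.1).symm
    simp [l2Sq]
  · refine Eq.trans ?_ (norm_toLp_sq v.2.2).symm
    simp only [semiSq, diffQuot_sq]

theorem Hhalf.core : SeminormedSpace.Core ℝ (Hhalf Γ) where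
  norm_nonneg v := Real.sqrt_nonneg _
  norm_smul c v := by rw [Hhalf.norm_eq, Hhalf.norm_eq, map_smul, norm_smul]
  norm_triangle v w := by
    rw [Hhalf.norm_eq, Hhalf.norm_eq, Hhalf.norm_eq, map_add]; exact norm_add_le _ _

instance : SeminormedAddCommGroup (Hhalf Γ) := SeminormedAddCommGroup.ofCore Hhalf.core

instance : NormedSpace ℝ (Hhalf Γ) where
  norm_smul_le c v := (Hhalf.core.norm_smul c v).le

variable (Γ) in
/-- `H^{-1/2}(Γ)`: the dual of `H^{1/2}(Γ)` with the dual norm. -/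
abbrev HmHalf : Type := StrongDual ℝ (Hhalf Γ)

/-- `H^{1/2}_{00}(ω)` for `ω ⊆ Γ`. Its elements are identified with their extensions by zero: the
functions in `H^{1/2}(Γ)` that vanish almost everywhere on `Γ ∖ ω`. -/
def HhalfZZ (ω : Set (E (d + 1))) : Set (Hhalf Γ) :=
  {v | ∀ᵐ s ∂(surf Γ), s ∉ ω → v s = 0}

/-- The norm in `H̃^{-1/2}(ω)`, the dual of `H^{1/2}_{00}(ω)` normed by `v ↦ |v|_{1/2,Γ}`: the
supremum of `⟨ζ, v⟩ / |v|_{1/2,Γ}` in `[0, ∞]` (with `0 / 0 = 0`, `a / 0 = ∞` for `a > 0`). -/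
def tildeNorm (ω : Set (E (d + 1))) (ζ : HmHalf Γ) : ℝ≥0∞ :=
  ⨆ v ∈ (HhalfZZ ω : Set (Hhalf Γ)), ENNReal.ofReal (ζ v) / ENNReal.ofReal (√(semiSq v))

end Half

/-! ### Meshes of `Γ` -/

/-- The reference simplex in `ℝᵈ`: the unit segment for `d = 1`, the unit triangle for `d = 2`. -/
def refSimplex (d : ℕ) : Set (E d) := {x | (∀ i, 0 ≤ x i) ∧ ∑ i, x i ≤ 1}

/-- The vertices `0, e₁, …, e_d` of the reference simplex. -/
def refVertex {d : ℕ} : Fin (d + 1) → E d :=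
  Fin.cases 0 (fun i => EuclideanSpace.single i 1)

/-- A decomposition of `Γ` into finitely many closed, non-overlapping curvilinear segments
(`d = 1`) or triangles (`d = 2`), each one a homeomorphic image of the reference simplex. -/
structure Mesh {d : ℕ} (Γ : Set (E (d + 1))) where
  card : ℕ
  param : Fin card → E d → E (d + 1)
  continuousOn : ∀ i, ContinuousOn (param i) (refSimplex d)
  injOn : ∀ i, InjOn (param i) (refSimplex d)
  cover : ⋃ i, param i '' refSimplex d = Γ
  nonoverlap : ∀ i j, i ≠ j →
    surf Γ ((param i '' refSimplex d) ∩ (param j '' refSimplex d)) = 0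

namespace Mesh

variable {d : ℕ} {Γ : Set (E (d + 1))} (T : Mesh Γ)

/-- The elements of the mesh. -/
def elem (i : Fin T.card) : Set (E (d + 1)) := T.param i '' refSimplex d

/-- The boundary `∂T` (end points of a segment, sides of a triangle) of an element. -/
def elemBoundary (i : Fin T.card) : Set (E (d + 1)) := T.param i '' frontier (refSimplex d)

/-- The mesh size `h`: the largest diameter of an element. -/
def meshSize : ℝ := ⨆ i, Metric.diam (T.elem i)

open Classical in
/-- The nodes of the mesh: the vertices of its elements. -/
def nodes : Finset (E (d + 1)) :=
  Finset.univ.image fun p : Fin T.card × Fin (d + 1) => T.param p.1 (refVertex p.2)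

/-- The patch `ω_y`: the union of the elements whose boundary contains `y`. -/
def patch (y : E (d + 1)) : Set (E (d + 1)) := ⋃ i, ⋃ (_ : y ∈ T.elemBoundary i), T.elem i

/-- Shape regularity with constant `κ`: after scaling by the diameter of the element, the
parametrization of each element is bi-Lipschitz with constant `κ`. -/
def ShapeRegular (κ : ℝ) : Prop :=
  ∀ i, ∀ x ∈ refSimplex d, ∀ y ∈ refSimplex d,
    κ⁻¹ * Metric.diam (T.elem i) * dist x y ≤ dist (T.param i x) (T.param i y) ∧
    dist (T.param i x) (T.param i y) ≤ κ * Metric.diam (T.elem i) * dist x y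

/-- Quasi-uniformity with constant `κ`. -/
def QuasiUniform (κ : ℝ) : Prop := ∀ i, T.meshSize ≤ κ * Metric.diam (T.elem i)

end Mesh

/-! ### The space `W^{1,∞}_0(ω)` -/

section W

variable {d : ℕ} (Γ ω : Set (E (d + 1))) (φ : E (d + 1) → ℝ)

/-- `‖φ‖_{0,∞,ω}` for a continuous function `φ`. -/
def supNorm : ℝ≥0∞ := ⨆ s ∈ ω, ‖φ s‖ₑ

/-- `|φ|_{1,∞}`: the supremum of the tangential gradient of `φ` along `Γ`, that is, the best
Lipschitz constant of `φ` with respect to the geodesic distance of `Γ`. -/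
def lipSeminorm : ℝ≥0∞ := ⨆ s ∈ Γ, ⨆ t ∈ Γ, edist (φ s) (φ t) / geodesicEDist Γ s t

/-- `φ ∈ W^{1,∞}_0(ω)`, `ω` a closed subset of `Γ`: `φ`, extended by zero outside `ω`, is a bounded
function on `Γ`, Lipschitz for the geodesic distance (so it vanishes on the boundary of `ω` relative
to `Γ`, and `|φ|_{1,∞,ω}` is the seminorm of the extension). -/
structure MemW1InfZero : Prop where
  eq_zero : ∀ s ∈ Γ, s ∉ ω → φ s = 0
  bounded : supNorm ω φ ≠ ∞
  lipschitz : lipSeminorm Γ φ ≠ ∞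

end W

end TraceNorm

end

noncomputable section

namespace TraceNorm

/-! Put ξ = ζ - Πζ. As Π is bounded, the triangle inequality reduces the claim to the equivalence of
‖ξ‖² and ∑ ‖ξ‖² over the patches. Orthogonality to the φ^y enters twice: ξ kills the constants,
because ∑ φ^y = 1, and it kills every a_y φ^y.

Upper bound (`sum_tildeNorm_sq_le`): by Poincaré on Γ, |ξ(v)| ≲ ‖ξ‖ |v|. Local test functions,
scaled so that ξ(v_y) = |v_y|², are added up to a single one. The seminorm is nonlocal, but v_y(s) -
v_y(t) vanishes unless ω_y contains s or t, so bounded overlap still gives |∑ v_y|² ≲ ∑ |v_y|²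
(`semiSq_sum_le`).

Lower bound (`norm_sq_le_sum_tildeNorm`): in v = ∑ φ^y (v - a_y) + ∑ a_y φ^y only the first sum is
seen by ξ. Its terms are controlled by the seminorm of v over ω_y × ω_y (`exists_partition_bound`).
Indeed the product rule leaves, besides that seminorm, the integral of |v - a_y|² over ω_y times
sup_s ∫ |φ^y(s) - φ^y(t)|² / |s - t|ⁿ dt. The supremum is O(1/h), because φ^y is bounded and varies
on the scale h, and Poincaré on the patch gains the compensating factor h.

The geometry enters only through surf(B_r) ≲ r^d, element measures ≳ h^d and patch diameters ≤ 2h;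
the first two, combined by packing, bound the overlap. -/

/-! ### The truncated kernel integral -/

/-- These are the weights of the dyadic shells around a point. Both tails are geometric: 2^(-k) for
k ≥ 0, where the minimum is 1, and at most 4 · 2^k for k ≤ 0. -/
theorem summable_min_one_four_zpow_div :
    Summable fun k : ℤ => min 1 ((2 : ℝ) ^ (k + 1)) ^ 2 / 2 ^ k := by
  have h2 : Summable fun n : ℕ => 4 * (1 / 2 : ℝ) ^ n :=
    summable_geometric_two.mul_left 4
  refine Summable.of_nat_of_neg ?_ ?_
  · refine Summable.of_nonneg_of_le (fun n => by positivity) (fun n => ?_) h2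
    have h1 : min 1 ((2 : ℝ) ^ ((n : ℤ) + 1)) ^ 2 ≤ 1 :=
      pow_le_one₀ (by positivity) (min_le_left _ _)
    calc _ ≤ 1 / (2 : ℝ) ^ (n : ℤ) := by gcongr
      _ = (1 / 2 : ℝ) ^ n := by simp
      _ ≤ _ := by linarith [show (0 : ℝ) ≤ (1 / 2) ^ n by positivity]
  · refine Summable.of_nonneg_of_le (fun n => by positivity) (fun n => ?_) h2
    calc min 1 ((2 : ℝ) ^ (-(n : ℤ) + 1)) ^ 2 / 2 ^ (-(n : ℤ))
        ≤ ((2 : ℝ) ^ (-(n : ℤ) + 1)) ^ 2 / 2 ^ (-(n : ℤ)) := by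
          gcongr; exact min_le_right _ _
      _ = 4 * (1 / 2 : ℝ) ^ n := by
          rw [zpow_add₀ (by norm_num), zpow_neg, zpow_natCast, one_div, inv_pow]; field_simp; norm_num

/-- For a measure that is `d`-dimensional from above, `∫ min(1, |s - t| / h)² / |s - t|ᵈ⁺¹` is
of the order `1 / h`. -/
theorem exists_lintegral_kernel_le (d : ℕ) (A : ℝ≥0) :
    ∃ C : ℝ≥0, ∀ μ : Measure (E (d + 1)),
      (∀ x r, 0 ≤ r → μ (Metric.closedBall x r) ≤ A * ENNReal.ofReal (r ^ d)) →
      ∀ h : ℝ, 0 < h → ∀ s,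
        ∫⁻ t, ENNReal.ofReal (min 1 (dist s t / h) ^ 2 / dist s t ^ (d + 1)) ∂μ
          ≤ C * ENNReal.ofReal h⁻¹ := by
  set S : ℝ≥0∞ := ∑' k : ℤ, ENNReal.ofReal (min 1 ((2 : ℝ) ^ (k + 1)) ^ 2 / 2 ^ k) with hS
  have hSfin : S ≠ ∞ := summable_min_one_four_zpow_div.tsum_ofReal_ne_top
  refine ⟨A * 2 ^ d * S.toNNReal, fun μ hμ h hh s => ?_⟩
  -- On the shell 2^k h < |s - t| ≤ 2^(k+1) h the kernel is at most this constant. The shell is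
  -- enlarged to a ball, whose measure is known.
  let f : ℤ → E (d + 1) → ℝ≥0∞ := fun k => (Metric.closedBall s (2 ^ (k + 1) * h)).indicator
    fun _ => ENNReal.ofReal (min 1 ((2 : ℝ) ^ (k + 1)) ^ 2 / (2 ^ k * h) ^ (d + 1))
  have hpt : ∀ t, ENNReal.ofReal (min 1 (dist s t / h) ^ 2 / dist s t ^ (d + 1))
      ≤ ∑' k, f k t := by
    intro t
    rcases eq_or_ne s t with rfl | hst
    · simp
    have hD : 0 < dist s t := dist_pos.2 hst
    obtain ⟨k, hk1, hk2⟩ := exists_mem_Ioc_zpow (div_pos hD hh) (one_lt_two : (1 : ℝ) < 2)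
    have hk3 : dist s t ≤ 2 ^ (k + 1) * h := (div_le_iff₀ hh).1 hk2
    have hk4 : 2 ^ k * h ≤ dist s t := ((lt_div_iff₀ hh).1 hk1).le
    refine le_trans ?_ (ENNReal.le_tsum k)
    have hmem : t ∈ Metric.closedBall s (2 ^ (k + 1) * h) := by
      rwa [Metric.mem_closedBall, dist_comm]
    simp only [f, indicator_of_mem hmem]
    gcongr
  have hf : ∀ k, ∫⁻ t, f k t ∂μ ≤
      A * 2 ^ d * ENNReal.ofReal h⁻¹ *
        ENNReal.ofReal (min 1 ((2 : ℝ) ^ (k + 1)) ^ 2 / 2 ^ k) := by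
    intro k
    rw [lintegral_indicator_const Metric.isClosed_closedBall.measurableSet]
    calc _ ≤ ENNReal.ofReal (min 1 ((2 : ℝ) ^ (k + 1)) ^ 2 / (2 ^ k * h) ^ (d + 1)) *
          (A * ENNReal.ofReal ((2 ^ (k + 1) * h) ^ d)) := by
            gcongr; exact hμ _ _ (by positivity)
      _ = A * ENNReal.ofReal (min 1 ((2 : ℝ) ^ (k + 1)) ^ 2 / (2 ^ k * h) ^ (d + 1) *
            (2 ^ (k + 1) * h) ^ d) := by
            rw [ENNReal.ofReal_mul (by positivity)]; ring
      _ = A * ENNReal.ofReal (2 ^ d * h⁻¹ * (min 1 ((2 : ℝ) ^ (k + 1)) ^ 2 / 2 ^ k)) := by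
            congr 2
            generalize min 1 ((2 : ℝ) ^ (k + 1)) = m
            rw [zpow_add₀ (by norm_num)]
            have : (0 : ℝ) < 2 ^ k := by positivity
            generalize (2 : ℝ) ^ k = q at *
            rw [mul_pow, mul_pow, mul_pow, pow_succ, pow_succ]
            field_simp
            ring
      _ = _ := by
            rw [ENNReal.ofReal_mul (by positivity), ENNReal.ofReal_mul (by positivity),
              ENNReal.ofReal_pow (by norm_num)]
            simp only [ENNReal.ofReal_ofNat]; ring
  calc _ ≤ ∫⁻ t, ∑' k, f k t ∂μ := lintegral_mono hpt
    _ = ∑' k, ∫⁻ t, f k t ∂μ := lintegral_tsum fun k =>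
        (measurable_const.indicator Metric.isClosed_closedBall.measurableSet).aemeasurable
    _ ≤ ∑' k, A * 2 ^ d * ENNReal.ofReal h⁻¹ *
        ENNReal.ofReal (min 1 ((2 : ℝ) ^ (k + 1)) ^ 2 / 2 ^ k) := ENNReal.tsum_le_tsum hf
    _ = _ := by
        rw [ENNReal.tsum_mul_left, ← hS]
        push_cast
        rw [ENNReal.coe_toNNReal hSfin]; ring

theorem enorm_sq_eq_ofReal (x : ℝ) : ‖x‖ₑ ^ 2 = ENNReal.ofReal (x ^ 2) := by
  rw [Real.enorm_eq_ofReal_abs, ← ENNReal.ofReal_pow (abs_nonneg _), sq_abs]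

theorem two_mul_ofReal (x : ℝ) : 2 * ENNReal.ofReal x = ENNReal.ofReal (2 * x) := by
  rw [ENNReal.ofReal_mul zero_le_two, ENNReal.ofReal_ofNat]

/-! ### Poincaré and product estimates for the difference quotient -/

section
variable {d : ℕ} {μ : Measure (E (d + 1))}

theorem aestronglyMeasurable_diffQuot [SFinite μ] {v : E (d + 1) → ℝ}
    (hv : AEStronglyMeasurable v μ) : AEStronglyMeasurable (diffQuot v) (μ.prod μ) := by
  have h : AEStronglyMeasurable
      (fun p : E (d + 1) × E (d + 1) => (√(dist p.1 p.2 ^ (d + 1)))⁻¹) (μ.prod μ) := by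
    have : Measurable
      (fun p : E (d + 1) × E (d + 1) => (√(dist p.1 p.2 ^ (d + 1)))⁻¹) := by fun_prop
    exact this.aestronglyMeasurable
  exact (hv.comp_fst.sub hv.comp_snd).mul h

theorem aestronglyMeasurable_diffQuot_left {v : E (d + 1) → ℝ}
    (hv : AEStronglyMeasurable v μ) (s : E (d + 1)) :
    AEStronglyMeasurable (fun t => diffQuot v (s, t)) μ := by
  have h : Measurable (fun t : E (d + 1) => (√(dist s t ^ (d + 1)))⁻¹) := by fun_prop
  have h2 : AEStronglyMeasurable (fun t => v s - v t) μ := aestronglyMeasurable_const.sub hv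
  exact h2.mul h.aestronglyMeasurable

theorem enorm_diffQuot_sq (v : E (d + 1) → ℝ) (s t : E (d + 1)) :
    ‖diffQuot v (s, t)‖ₑ ^ 2 =
      ENNReal.ofReal ((v s - v t) ^ 2 / dist s t ^ (d + 1)) := by
  rw [enorm_sq_eq_ofReal, diffQuot_sq, sq_abs]

/-- A Poincaré inequality on a set `ω` of diameter at most `D`. -/
theorem exists_const_lintegral_sub_sq_le [IsFiniteMeasure μ] {v : E (d + 1) → ℝ}
    (hv : AEStronglyMeasurable v μ) {ω : Set (E (d + 1))} (hω : MeasurableSet ω) {D : ℝ}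
    (hD : ∀ s ∈ ω, ∀ t ∈ ω, dist s t ≤ D) :
    ∃ a : ℝ, ∫⁻ s in ω, ‖v s - a‖ₑ ^ 2 ∂μ ≤
      ENNReal.ofReal (D ^ (d + 1)) / μ ω *
        ∫⁻ p in ω ×ˢ ω, ‖diffQuot v p‖ₑ ^ 2 ∂(μ.prod μ) := by
  rcases eq_or_ne (μ ω) 0 with h0 | h0
  · exact ⟨0, by rw [setLIntegral_measure_zero _ _ h0]; simp⟩
  have hvω := hv.restrict (s := ω)
  have hmeas : AEMeasurable (fun p : E (d + 1) × E (d + 1) => ‖v p.2 - v p.1‖ₑ ^ 2)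
      ((μ.restrict ω).prod (μ.restrict ω)) :=
    (hvω.comp_snd.sub hvω.comp_fst).enorm.pow_const 2
  -- The constant is a value v t rather than the mean: some t makes the integral of |v s - v t|²
  -- over s at most its average over ω.
  obtain ⟨t, -, ht⟩ := exists_le_setLAverage (μ := μ) (s := ω) h0 (measure_ne_top _ _)
    hmeas.lintegral_prod_right'
  refine ⟨v t, ht.trans ?_⟩
  rw [setLAverage_eq, ENNReal.div_eq_inv_mul, ENNReal.div_eq_inv_mul, mul_assoc]
  gcongr
  rw [← lintegral_prod _ hmeas, Measure.prod_restrict,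
    ← lintegral_const_mul'' _ (((aestronglyMeasurable_diffQuot hv).enorm.pow_const 2).mono_measure
      Measure.restrict_le_self)]
  refine setLIntegral_mono' (hω.prod hω) fun p hp => ?_
  obtain ⟨s, t⟩ := p
  rw [enorm_diffQuot_sq, ← ENNReal.ofReal_mul (pow_nonneg
    (dist_nonneg.trans (hD s hp.1 s hp.1)) _), enorm_sq_eq_ofReal]
  apply ENNReal.ofReal_le_ofReal
  rcases eq_or_ne s t with rfl | hst
  · simp
  have hd : 0 < dist s t := dist_pos.2 hst
  calc (v t - v s) ^ 2 = dist s t ^ (d + 1) * ((v s - v t) ^ 2 / dist s t ^ (d + 1)) := by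
        field_simp; ring
    _ ≤ _ := by
        gcongr
        exact hD s hp.1 t hp.2

/-- Multiplication by a cut-off function. -/
theorem lintegral_diffQuot_mul_le [IsFiniteMeasure μ] {φ w : E (d + 1) → ℝ}
    {Γ ω : Set (E (d + 1))} (hΓ : ∀ᵐ s ∂μ, s ∈ Γ) (hω : MeasurableSet ω)
    (hφm : AEStronglyMeasurable φ μ) (hw : AEStronglyMeasurable w μ)
    (hφ0 : ∀ s ∈ Γ, s ∉ ω → φ s = 0) {c : ℝ} (hφc : ∀ s ∈ Γ, |φ s| ≤ c) {B : ℝ≥0∞}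
    (hB : ∀ s ∈ Γ, ∫⁻ t, ‖diffQuot φ (s, t)‖ₑ ^ 2 ∂μ ≤ B) :
    ∫⁻ p, ‖diffQuot (φ * w) p‖ₑ ^ 2 ∂(μ.prod μ) ≤
      2 * ENNReal.ofReal (c ^ 2) * ∫⁻ p in ω ×ˢ ω, ‖diffQuot w p‖ₑ ^ 2 ∂(μ.prod μ) +
      4 * B * ∫⁻ s in ω, ‖w s‖ₑ ^ 2 ∂μ := by
  -- The second term of the product rule φ(t) (w(s) - w(t)) + w(s) (φ(s) - φ(t)). If only s lies in
  -- ω, it is the whole difference; if only t does, the swapped term is. Adding F and its swap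
  -- covers all cases and gives the factor 4.
  let F : E (d + 1) × E (d + 1) → ℝ≥0∞ := fun p =>
    ω.indicator (fun s => ‖w s‖ₑ ^ 2) p.1 * ‖diffQuot φ p‖ₑ ^ 2
  have hwm : AEMeasurable (ω.indicator (fun s => ‖w s‖ₑ ^ 2)) μ :=
    (hw.enorm.pow_const 2).indicator hω
  have hφq := (aestronglyMeasurable_diffQuot hφm).enorm.pow_const 2
  have hwq := (aestronglyMeasurable_diffQuot hw).enorm.pow_const 2
  have hF : AEMeasurable F (μ.prod μ) := hwm.comp_fst.mul hφq
  have hFint : ∫⁻ p, F p ∂(μ.prod μ) ≤ B * ∫⁻ s in ω, ‖w s‖ₑ ^ 2 ∂μ := by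
    rw [lintegral_prod _ hF, ← lintegral_indicator hω, ← lintegral_const_mul'' _ hwm]
    refine lintegral_mono_ae ?_
    filter_upwards [hΓ] with s hs
    simp only [F]
    rw [lintegral_const_mul'' _ ((aestronglyMeasurable_diffQuot_left hφm s).enorm.pow_const 2),
      mul_comm]
    gcongr
    exact hB s hs
  have hFswap : ∫⁻ p, F p.swap ∂(μ.prod μ) = ∫⁻ p, F p ∂(μ.prod μ) := lintegral_prod_swap F
  have hpt : ∀ᵐ p ∂(μ.prod μ), ‖diffQuot (φ * w) p‖ₑ ^ 2 ≤
      2 * ENNReal.ofReal (c ^ 2) * (ω ×ˢ ω).indicator (fun p => ‖diffQuot w p‖ₑ ^ 2) p +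
        (2 * F p + 2 * F p.swap) := by
    filter_upwards [Measure.quasiMeasurePreserving_fst.ae hΓ,
      Measure.quasiMeasurePreserving_snd.ae hΓ] with p hs ht
    obtain ⟨s, t⟩ := p
    simp only at hs ht
    by_cases h1 : s ∈ ω
    · by_cases h2 : t ∈ ω
      · rw [indicator_of_mem (show (s, t) ∈ ω ×ˢ ω from ⟨h1, h2⟩)]
        refine le_trans ?_ (add_le_add le_rfl (le_self_add))
        simp only [F, indicator_of_mem h1, enorm_diffQuot_sq]
        simp only [enorm_sq_eq_ofReal]
        rw [← ENNReal.ofReal_mul (sq_nonneg _), mul_assoc, ← ENNReal.ofReal_mul (sq_nonneg _),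
          ← mul_add, ← ENNReal.ofReal_add (by positivity) (by positivity),
          two_mul_ofReal]
        apply ENNReal.ofReal_le_ofReal
        have hc2 : φ t ^ 2 ≤ c ^ 2 := by
          rw [← sq_abs]; exact pow_le_pow_left₀ (abs_nonneg _) (hφc t ht) 2
        have e : 2 * (c ^ 2 * ((w s - w t) ^ 2 / dist s t ^ (d + 1)) +
            w s ^ 2 * ((φ s - φ t) ^ 2 / dist s t ^ (d + 1))) =
            (2 * (c ^ 2 * (w s - w t) ^ 2) + 2 * (w s * (φ s - φ t)) ^ 2) /
              dist s t ^ (d + 1) := by ring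
        rw [e]
        gcongr
        have : φ t ^ 2 * (w s - w t) ^ 2 ≤ c ^ 2 * (w s - w t) ^ 2 := by gcongr
        simp only [Pi.mul_apply]
        nlinarith [sq_nonneg (φ t * (w s - w t) - w s * (φ s - φ t))]
      · refine le_trans ?_ le_add_self
        refine le_trans ?_ le_self_add
        refine le_trans ?_ (le_mul_of_one_le_left' one_le_two)
        have h0 := hφ0 t ht h2
        simp only [F, indicator_of_mem h1, enorm_diffQuot_sq, Pi.mul_apply, h0]
        simp only [enorm_sq_eq_ofReal]
        rw [← ENNReal.ofReal_mul (sq_nonneg _)]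
        apply ENNReal.ofReal_le_ofReal
        apply le_of_eq; ring
    · by_cases h2 : t ∈ ω
      · refine le_trans ?_ le_add_self
        refine le_trans ?_ le_add_self
        refine le_trans ?_ (le_mul_of_one_le_left' one_le_two)
        have h0 := hφ0 s hs h1
        simp only [F, Prod.swap, indicator_of_mem h2, enorm_diffQuot_sq, Pi.mul_apply, h0]
        simp only [enorm_sq_eq_ofReal]
        rw [← ENNReal.ofReal_mul (sq_nonneg _)]
        apply ENNReal.ofReal_le_ofReal
        apply le_of_eq; rw [dist_comm]; ring
      · simp [diffQuot, hφ0 s hs h1, hφ0 t ht h2]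
  have hF2 : AEMeasurable (fun p : E (d + 1) × E (d + 1) => F p.swap) (μ.prod μ) := hF.prod_swap
  calc _ ≤ _ := lintegral_mono_ae hpt
    _ = 2 * ENNReal.ofReal (c ^ 2) * ∫⁻ p in ω ×ˢ ω, ‖diffQuot w p‖ₑ ^ 2 ∂(μ.prod μ) +
        (2 * ∫⁻ p, F p ∂(μ.prod μ) + 2 * ∫⁻ p, F p ∂(μ.prod μ)) := by
      rw [lintegral_add_left' ((hwq.indicator (hω.prod hω)).const_mul _),
        lintegral_add_right' _ (hF2.const_mul 2), lintegral_const_mul'' _ hF,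
        lintegral_const_mul'' _ hF2, hFswap,
        lintegral_const_mul'' _ (hwq.indicator (hω.prod hω)), lintegral_indicator (hω.prod hω)]
    _ ≤ _ := by
      gcongr
      rw [← add_mul, show (2 : ℝ≥0∞) + 2 = 4 by norm_num, mul_assoc]
      gcongr

end

/-! ### Hausdorff measure and the reference simplex -/

/-- The normalizing factor of `μHE[d]` relative to `μH[d]` depends on d only, so it is the same in X
and Y. -/
theorem _root_.LipschitzOnWith.euclideanHausdorffMeasure_image_le {X Y : Type*}
    [MetricSpace X] [MeasurableSpace X] [BorelSpace X] [MetricSpace Y] [MeasurableSpace Y]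
    [BorelSpace Y] {K : ℝ≥0} {f : X → Y} {s : Set X} (hf : LipschitzOnWith K f s) (d : ℕ) :
    (μHE[d] : Measure Y) (f '' s) ≤ (K : ℝ≥0∞) ^ d * (μHE[d] : Measure X) s := by
  simp only [Measure.euclideanHausdorffMeasure_def, Measure.smul_apply, ENNReal.smul_def,
    smul_eq_mul]
  rw [mul_left_comm]
  gcongr
  simpa using hf.hausdorffMeasure_image_le d.cast_nonneg

theorem isClosed_refSimplex (d : ℕ) : IsClosed (refSimplex d) := by
  have h1 : IsClosed {x : E d | ∀ i, 0 ≤ x i} := by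
    simp only [ofPred_forall]
    exact isClosed_iInter fun i => isClosed_le continuous_const (by fun_prop)
  exact h1.inter (isClosed_le (f := fun x : E d => ∑ i, x i) (by fun_prop) continuous_const)

theorem isBounded_refSimplex (d : ℕ) : Bornology.IsBounded (refSimplex d) := by
  refine (Metric.isBounded_closedBall (x := (0 : E d)) (r := √d)).subset fun x hx => ?_
  rw [mem_closedBall_zero_iff, EuclideanSpace.norm_eq]
  apply Real.sqrt_le_sqrt
  calc ∑ i, ‖x i‖ ^ 2 ≤ ∑ _i : Fin d, (1 : ℝ) := by
        refine Finset.sum_le_sum fun i _ => pow_le_one₀ (norm_nonneg _) ?_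
        rw [Real.norm_of_nonneg (hx.1 i)]
        exact (Finset.single_le_sum (fun j _ => hx.1 j) (Finset.mem_univ i)).trans hx.2
    _ = d := by simp

theorem isCompact_refSimplex (d : ℕ) : IsCompact (refSimplex d) :=
  Metric.isCompact_of_isClosed_isBounded (isClosed_refSimplex d) (isBounded_refSimplex d)

theorem refVertex_mem {d : ℕ} (k : Fin (d + 1)) : refVertex k ∈ refSimplex d := by
  refine Fin.cases ?_ (fun i => ?_) k
  · simp [refVertex, refSimplex]
  · refine ⟨fun j => ?_, ?_⟩
    · simp only [refVertex, Fin.cases_succ]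
      rw [PiLp.single_apply]
      split_ifs <;> norm_num
    · simp [refVertex]

theorem volume_refSimplex_ne_zero (d : ℕ) : volume (refSimplex d) ≠ 0 := by
  let U : Set (E d) := {x | (∀ i, 0 < x i) ∧ ∑ i, x i < 1}
  have hU : IsOpen U := by
    have h1 : IsOpen {x : E d | ∀ i, 0 < x i} := by
      simp only [ofPred_forall]
      exact isOpen_iInter_of_finite fun i => isOpen_lt continuous_const (by fun_prop)
    exact h1.inter (isOpen_lt (f := fun x : E d => ∑ i, x i) (by fun_prop) continuous_const)
  have hne : U.Nonempty := by
    refine ⟨WithLp.toLp 2 fun _ => ((d : ℝ) + 1)⁻¹, fun i => ?_, ?_⟩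
    · simp only; positivity
    · simp only [Finset.sum_const, Finset.card_univ, Fintype.card_fin, nsmul_eq_mul]
      rw [← div_eq_mul_inv, div_lt_one (by positivity)]; linarith
  have hsub : U ⊆ refSimplex d := fun x hx => ⟨fun i => (hx.1 i).le, hx.2.le⟩
  exact ((hU.measure_pos volume hne).trans_le (measure_mono hsub)).ne'

/-! ### Geometry of shape regular, quasi-uniform meshes -/

namespace Mesh

variable {d : ℕ} {Γ : Set (E (d + 1))} (T : Mesh Γ)

theorem isCompact_elem (i : Fin T.card) : IsCompact (T.elem i) :=
  (isCompact_refSimplex d).image_of_continuousOn (T.continuousOn i)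

theorem measurableSet_elem (i : Fin T.card) : MeasurableSet (T.elem i) :=
  (T.isCompact_elem i).isClosed.measurableSet

theorem elem_subset (i : Fin T.card) : T.elem i ⊆ Γ :=
  (subset_iUnion T.elem i).trans T.cover.le

theorem measurableSet_patch (y : E (d + 1)) : MeasurableSet (T.patch y) :=
  MeasurableSet.iUnion fun i => MeasurableSet.iUnion fun _ => T.measurableSet_elem i

theorem mem_patch {s y : E (d + 1)} :
    s ∈ T.patch y ↔ ∃ i, y ∈ T.elemBoundary i ∧ s ∈ T.elem i := by
  simp [patch]

theorem elemBoundary_subset (i : Fin T.card) : T.elemBoundary i ⊆ T.elem i :=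
  image_mono (isClosed_refSimplex d).frontier_subset

theorem diam_elem_le (i : Fin T.card) : Metric.diam (T.elem i) ≤ T.meshSize :=
  le_ciSup (f := fun i => Metric.diam (T.elem i)) (finite_range _).bddAbove i

theorem dist_le_meshSize {i : Fin T.card} {s t : E (d + 1)} (hs : s ∈ T.elem i)
    (ht : t ∈ T.elem i) : dist s t ≤ T.meshSize :=
  (Metric.dist_le_diam_of_mem (T.isCompact_elem i).isBounded hs ht).trans (T.diam_elem_le i)

theorem dist_le_of_mem_patch {s t y : E (d + 1)} (hs : s ∈ T.patch y) (ht : t ∈ T.patch y) :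
    dist s t ≤ 2 * T.meshSize := by
  obtain ⟨i, hi, hs⟩ := T.mem_patch.1 hs
  obtain ⟨j, hj, ht⟩ := T.mem_patch.1 ht
  have h1 := T.dist_le_meshSize hs (T.elemBoundary_subset i hi)
  have h2 := T.dist_le_meshSize (T.elemBoundary_subset j hj) ht
  linarith [dist_triangle s y t]

theorem diam_elem_pos (hd : 1 ≤ d) (i : Fin T.card) : 0 < Metric.diam (T.elem i) := by
  have hne : (refVertex 0 : E d) ≠ refVertex (Fin.succ ⟨0, hd⟩) := by
    simp only [refVertex, Fin.cases_zero, Fin.cases_succ]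
    intro h
    have := congrArg (fun x : E d => x ⟨0, hd⟩) h
    simp at this
  refine lt_of_lt_of_le (dist_pos.2 fun h => hne (T.injOn i (refVertex_mem _) (refVertex_mem _) h))
    (Metric.dist_le_diam_of_mem (T.isCompact_elem i).isBounded
      (mem_image_of_mem _ (refVertex_mem _)) (mem_image_of_mem _ (refVertex_mem _)))

theorem meshSize_pos (hd : 1 ≤ d) (i : Fin T.card) : 0 < T.meshSize :=
  (T.diam_elem_pos hd i).trans_le (T.diam_elem_le i)

theorem kappa_pos (hd : 1 ≤ d) {κ : ℝ} (hT : T.QuasiUniform κ) (i : Fin T.card) : 0 < κ :=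
  pos_of_mul_pos_left ((T.meshSize_pos hd i).trans_le (hT i)) Metric.diam_nonneg

theorem nonempty_fin_card (hΓ : Γ.Nonempty) : Nonempty (Fin T.card) := by
  obtain ⟨s, hs⟩ := hΓ
  rw [← T.cover] at hs
  exact ⟨(mem_iUnion.1 hs).choose⟩

theorem surf_elem (i : Fin T.card) : surf Γ (T.elem i) = (μHE[d] : Measure _) (T.elem i) :=
  Measure.restrict_eq_self _ (T.elem_subset i)

theorem isCompact (T : Mesh Γ) : IsCompact Γ := by
  rw [← T.cover]; exact isCompact_iUnion T.isCompact_elem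

variable {T} {κ : ℝ}

theorem ShapeRegular.dist_le (hd : 1 ≤ d) (hκ : 0 < κ) (hT : T.ShapeRegular κ) {i : Fin T.card}
    {x y : E d} (hx : x ∈ refSimplex d) (hy : y ∈ refSimplex d) :
    dist x y ≤ κ / Metric.diam (T.elem i) * dist (T.param i x) (T.param i y) := by
  have h := (hT i x hx y hy).1
  have hD := T.diam_elem_pos hd i
  calc dist x y = κ / Metric.diam (T.elem i) * (κ⁻¹ * Metric.diam (T.elem i) * dist x y) := by
        field_simp
    _ ≤ _ := by gcongr

/-- The inverse parametrization is Lipschitz with constant κ / diam and maps the element onto the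
reference simplex. -/
theorem ShapeRegular.volume_le (hd : 1 ≤ d) (hκ : 0 < κ) (hT : T.ShapeRegular κ)
    (i : Fin T.card) :
    volume (refSimplex d) ≤
      ENNReal.ofReal ((κ / Metric.diam (T.elem i)) ^ d) * surf Γ (T.elem i) := by
  have hD := T.diam_elem_pos hd i
  have hinv : LeftInvOn (Function.invFunOn (T.param i) (refSimplex d)) (T.param i)
    (refSimplex d) := (T.injOn i).leftInvOn_invFunOn
  have hl : LipschitzOnWith (κ / Metric.diam (T.elem i)).toNNReal
      (Function.invFunOn (T.param i) (refSimplex d)) (T.elem i) := by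
    refine LipschitzOnWith.of_dist_le_mul ?_
    rintro _ ⟨x, hx, rfl⟩ _ ⟨y, hy, rfl⟩
    rw [hinv hx, hinv hy, Real.coe_toNNReal _ (by positivity)]
    exact hT.dist_le hd hκ hx hy
  have h := hl.euclideanHausdorffMeasure_image_le d
  rw [elem, hinv.image_image, EuclideanSpace.euclideanHausdorffMeasure_eq_volume] at h
  rw [surf_elem, ENNReal.ofReal_pow (by positivity)]
  exact h

/-- The preimage of the ball lies in a ball of radius 2rκ/D, and mapping it forward costs (κD)^d.
The diameter D of the element cancels. -/
theorem ShapeRegular.surf_elem_inter_closedBall_le (hd : 1 ≤ d) (hκ : 0 < κ)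
    (hT : T.ShapeRegular κ) (i : Fin T.card) (x : E (d + 1)) {r : ℝ} (hr : 0 ≤ r) :
    surf Γ (T.elem i ∩ Metric.closedBall x r) ≤
      ENNReal.ofReal ((2 * κ ^ 2 * r) ^ d) * volume (Metric.closedBall (0 : E d) 1) := by
  have hD := T.diam_elem_pos hd i
  set D := Metric.diam (T.elem i)
  set S : Set (E d) := {u ∈ refSimplex d | T.param i u ∈ Metric.closedBall x r} with hS
  have hl : LipschitzOnWith (κ * D).toNNReal (T.param i) S := by
    refine LipschitzOnWith.of_dist_le_mul fun u hu w hw => ?_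
    rw [Real.coe_toNNReal _ (by positivity)]
    exact (hT i u hu.1 w hw.1).2
  have himg : T.elem i ∩ Metric.closedBall x r ⊆ T.param i '' S := by
    rintro _ ⟨⟨u, hu, rfl⟩, hx⟩
    exact ⟨u, ⟨hu, hx⟩, rfl⟩
  have hvol : volume S ≤ ENNReal.ofReal ((2 * r * (κ / D)) ^ d) *
      volume (Metric.closedBall (0 : E d) 1) := by
    rcases S.eq_empty_or_nonempty with h0 | ⟨u, hu⟩
    · rw [h0]; simp
    have hsub : S ⊆ Metric.closedBall u (2 * r * (κ / D)) := by
      intro w hw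
      refine (hT.dist_le (i := i) hd hκ hw.1 hu.1).trans ?_
      rw [mul_comm]
      gcongr
      have h1 := Metric.mem_closedBall.1 hw.2
      have h2 := Metric.mem_closedBall.1 hu.2
      linarith [dist_triangle_right (T.param i w) (T.param i u) x]
    refine (measure_mono hsub).trans ?_
    rw [Measure.addHaar_closedBall' _ _ (by positivity)]
    simp
  calc _ ≤ (μHE[d] : Measure _) (T.param i '' S) :=
        (Measure.restrict_apply_le _ _).trans (measure_mono himg)
    _ ≤ _ := hl.euclideanHausdorffMeasure_image_le d
    _ ≤ ENNReal.ofReal (κ * D) ^ d * (ENNReal.ofReal ((2 * r * (κ / D)) ^ d) *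
      volume (Metric.closedBall (0 : E d) 1)) := by
        rw [EuclideanSpace.euclideanHausdorffMeasure_eq_volume]
        gcongr
        exact le_rfl
    _ = _ := by
        rw [← ENNReal.ofReal_pow (by positivity), ← mul_assoc,
          ← ENNReal.ofReal_mul (by positivity), ← mul_pow]
        congr 3
        field_simp

/-- The surface measure of a surface that has a shape regular mesh is `d`-dimensional from above. -/
theorem ShapeRegular.exists_surf_closedBall_le (hd : 1 ≤ d) (hκ : 0 < κ)
    (hT : T.ShapeRegular κ) :
    ∃ A : ℝ≥0, ∀ x r, 0 ≤ r →
      surf Γ (Metric.closedBall x r) ≤ A * ENNReal.ofReal (r ^ d) := by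
  have hV : volume (Metric.closedBall (0 : E d) 1) ≠ ∞ := measure_closedBall_lt_top.ne
  -- The number of elements enters, so this constant is not uniform over meshes. One mesh is enough,
  -- since the estimate concerns Γ alone.
  refine ⟨T.card * (Real.toNNReal ((2 * κ ^ 2) ^ d) *
    (volume (Metric.closedBall (0 : E d) 1)).toNNReal), fun x r hr => ?_⟩
  calc surf Γ (Metric.closedBall x r) ≤ surf Γ (⋃ i, T.elem i ∩ Metric.closedBall x r) := by
        rw [← iUnion_inter]
        have : (⋃ i, T.elem i) = Γ := T.cover
        rw [this, surf, Measure.restrict_apply' T.isCompact.isClosed.measurableSet,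
          Measure.restrict_eq_self _ inter_subset_left, inter_comm]
    _ ≤ ∑ i, surf Γ (T.elem i ∩ Metric.closedBall x r) := measure_iUnion_fintype_le _ _
    _ ≤ ∑ _i : Fin T.card, _ := Finset.sum_le_sum fun i _ =>
        hT.surf_elem_inter_closedBall_le hd hκ i x hr
    _ = _ := by
        rw [Finset.sum_const, Finset.card_univ, Fintype.card_fin, nsmul_eq_mul, mul_pow,
          ENNReal.ofReal_mul (by positivity)]
        push_cast
        rw [ENNReal.coe_toNNReal hV]
        simp only [ENNReal.ofReal]
        ring

theorem isFiniteMeasure_surf (hΓ : Bornology.IsBounded Γ) {A : ℝ≥0}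
    (hA : ∀ x r, 0 ≤ r → surf Γ (Metric.closedBall x r) ≤ A * ENNReal.ofReal (r ^ d)) :
    IsFiniteMeasure (surf Γ) := by
  obtain ⟨r, hr⟩ := hΓ.subset_closedBall 0
  refine ⟨?_⟩
  rw [surf, Measure.restrict_apply_univ]
  calc (μHE[d] : Measure _) Γ = surf Γ Γ := (Measure.restrict_apply_self _ _).symm
    _ ≤ surf Γ (Metric.closedBall 0 (max r 0)) :=
        measure_mono (hr.trans (Metric.closedBall_subset_closedBall (le_max_left _ _)))
    _ ≤ _ := hA _ _ (le_max_right _ _)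
    _ < ∞ := ENNReal.mul_lt_top ENNReal.coe_lt_top ENNReal.ofReal_lt_top

/-- The measure of an element is at least of the order `hᵈ`. -/
theorem ShapeRegular.ofReal_meshSize_pow_le (hd : 1 ≤ d) (hκ : 0 < κ) (hT : T.ShapeRegular κ)
    (hQ : T.QuasiUniform κ) (i : Fin T.card) :
    ENNReal.ofReal (T.meshSize ^ d) * volume (refSimplex d) ≤
      ENNReal.ofReal ((κ ^ 2) ^ d) * surf Γ (T.elem i) := by
  have hD := T.diam_elem_pos hd i
  have hm := T.meshSize_pos hd i
  calc _ ≤ ENNReal.ofReal (T.meshSize ^ d) *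
        (ENNReal.ofReal ((κ / Metric.diam (T.elem i)) ^ d) * surf Γ (T.elem i)) := by
          gcongr; exact hT.volume_le hd hκ i
    _ = ENNReal.ofReal ((T.meshSize * (κ / Metric.diam (T.elem i))) ^ d) *
        surf Γ (T.elem i) := by
      rw [← mul_assoc, ← ENNReal.ofReal_mul (by positivity), ← mul_pow]
    _ ≤ _ := by
      gcongr
      rw [mul_div_assoc', div_le_iff₀ hD]
      nlinarith [hQ i]

open Classical in
/-- The number of elements in a ball of radius `2 h` is bounded. -/
theorem ShapeRegular.card_elem_le (hd : 1 ≤ d) (hκ : 0 < κ) (hT : T.ShapeRegular κ)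
    (hQ : T.QuasiUniform κ) {A : ℝ≥0}
    (hA : ∀ x r, 0 ≤ r → surf Γ (Metric.closedBall x r) ≤ A * ENNReal.ofReal (r ^ d))
    (s : E (d + 1)) :
    ((Finset.univ.filter fun i => T.elem i ⊆ Metric.closedBall s (2 * T.meshSize)).card : ℝ≥0∞) ≤
      ENNReal.ofReal ((2 * κ ^ 2) ^ d) * A / volume (refSimplex d) := by
  set I := Finset.univ.filter fun i => T.elem i ⊆ Metric.closedBall s (2 * T.meshSize) with hI
  rcases I.eq_empty_or_nonempty with h0 | ⟨i₀, -⟩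
  · simp [h0]
  have hm := T.meshSize_pos hd i₀
  have hV : volume (refSimplex d) ≠ ∞ := (isCompact_refSimplex d).measure_ne_top
  rw [ENNReal.le_div_iff_mul_le (Or.inl (volume_refSimplex_ne_zero d)) (Or.inl hV)]
  have hm0 : ENNReal.ofReal (T.meshSize ^ d) ≠ 0 := by
    rw [Ne, ENNReal.ofReal_eq_zero, not_le]; positivity
  rw [← ENNReal.mul_le_mul_iff_right hm0 ENNReal.ofReal_ne_top]
  -- Packing: the elements overlap in null sets and all lie in one ball of radius 2h.
  have hsum : ∑ i ∈ I, surf Γ (T.elem i) ≤ A * ENNReal.ofReal ((2 * T.meshSize) ^ d) := by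
    rw [← measure_biUnion_finset₀ (f := T.elem) (fun i _ j _ hij => T.nonoverlap i j hij)
      fun i _ => (T.measurableSet_elem i).nullMeasurableSet]
    refine (measure_mono (iUnion₂_subset fun i hi => ?_)).trans (hA s _ (by positivity))
    exact (Finset.mem_filter.1 hi).2
  calc ENNReal.ofReal (T.meshSize ^ d) * (I.card * volume (refSimplex d))
      = ∑ _i ∈ I, ENNReal.ofReal (T.meshSize ^ d) * volume (refSimplex d) := by
        rw [Finset.sum_const, nsmul_eq_mul]; ring
    _ ≤ ∑ i ∈ I, ENNReal.ofReal ((κ ^ 2) ^ d) * surf Γ (T.elem i) :=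
        Finset.sum_le_sum fun i _ => hT.ofReal_meshSize_pow_le hd hκ hQ i
    _ = ENNReal.ofReal ((κ ^ 2) ^ d) * ∑ i ∈ I, surf Γ (T.elem i) := by rw [Finset.mul_sum]
    _ ≤ ENNReal.ofReal ((κ ^ 2) ^ d) * (A * ENNReal.ofReal ((2 * T.meshSize) ^ d)) := by gcongr
    _ = _ := by
        rw [mul_pow, mul_pow, ENNReal.ofReal_mul (by positivity),
          ENNReal.ofReal_mul (by positivity)]; ring

open Classical in
/-- The overlap of the patches is bounded. -/
theorem ShapeRegular.exists_card_patch_le (hd : 1 ≤ d) (hκ : 0 < κ) (A : ℝ≥0)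
    (hA : ∀ x r, 0 ≤ r → surf Γ (Metric.closedBall x r) ≤ A * ENNReal.ofReal (r ^ d)) :
    ∃ N : ℕ, ∀ T : Mesh Γ, T.ShapeRegular κ → T.QuasiUniform κ → ∀ s,
      (T.nodes.filter fun y => s ∈ T.patch y).card ≤ N := by
  have hV : ENNReal.ofReal ((2 * κ ^ 2) ^ d) * A / volume (refSimplex d) ≠ ∞ :=
    ENNReal.div_ne_top (by finiteness) (volume_refSimplex_ne_zero d)
  obtain ⟨N, hN⟩ := ENNReal.exists_nat_gt hV
  refine ⟨N * (d + 1), fun T hT hQ s => ?_⟩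
  set I := Finset.univ.filter fun i => T.elem i ⊆ Metric.closedBall s (2 * T.meshSize) with hI
  have hIN : I.card ≤ N := by
    exact_mod_cast (hT.card_elem_le hd hκ hQ hA s).trans hN.le
  -- A node y whose patch contains s is within h of s, and is a vertex of an element of diameter at
  -- most h; that element lies in the ball of radius 2h around s and has d + 1 vertices.
  have hsub : (T.nodes.filter fun y => s ∈ T.patch y) ⊆
      (I ×ˢ (Finset.univ : Finset (Fin (d + 1)))).image fun p => T.param p.1 (refVertex p.2) := by
    intro y hy
    obtain ⟨hy, hs⟩ := Finset.mem_filter.1 hy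
    obtain ⟨⟨j, k⟩, -, rfl⟩ := Finset.mem_image.1 hy
    refine Finset.mem_image.2 ⟨(j, k), Finset.mem_product.2 ⟨?_, Finset.mem_univ _⟩, rfl⟩
    refine Finset.mem_filter.2 ⟨Finset.mem_univ _, fun t ht => ?_⟩
    obtain ⟨i, hi, hs⟩ := T.mem_patch.1 hs
    have h1 := T.dist_le_meshSize ht (mem_image_of_mem _ (refVertex_mem k))
    have h2 := T.dist_le_meshSize (T.elemBoundary_subset i hi) hs
    rw [Metric.mem_closedBall]
    linarith [dist_triangle t (T.param j (refVertex k)) s]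
  calc _ ≤ _ := Finset.card_le_card hsub
    _ ≤ _ := Finset.card_image_le
    _ = I.card * (d + 1) := by simp
    _ ≤ _ := by gcongr

/-- The measure of a patch is at least of the order `hᵈ`, unless the patch is empty. -/
theorem ShapeRegular.le_surf_patch (hd : 1 ≤ d) (hκ : 0 < κ) (hT : T.ShapeRegular κ)
    (hQ : T.QuasiUniform κ) {y : E (d + 1)} (hy : (T.patch y).Nonempty) :
    ENNReal.ofReal (T.meshSize ^ d) * volume (refSimplex d) ≤
      ENNReal.ofReal ((κ ^ 2) ^ d) * surf Γ (T.patch y) := by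
  obtain ⟨s, hs⟩ := hy
  obtain ⟨i, hi, -⟩ := T.mem_patch.1 hs
  refine (hT.ofReal_meshSize_pow_le hd hκ hQ i).trans ?_
  gcongr
  exact fun t ht => T.mem_patch.2 ⟨i, hi, ht⟩

end Mesh

/-! ### Functionals on H^{1/2}(Γ) -/

theorem memLp_two_iff {α : Type*} [MeasurableSpace α] {μ : Measure α} {f : α → ℝ}
    (hf : AEStronglyMeasurable f μ) : MemLp f 2 μ ↔ ∫⁻ x, ‖f x‖ₑ ^ 2 ∂μ < ∞ := by
  rw [MemLp, and_iff_right hf, eLpNorm_lt_top_iff_lintegral_rpow_enorm_lt_top (by norm_num)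
    (by norm_num)]
  simp

/-- All suprema are approached simultaneously by sequences, and the bound passes to the limit.
Values in `ℝ≥0∞` allow suprema not yet known to be finite. -/
theorem sum_biSup_sq_le {ι α : Type*} (Y : Finset ι) (S : ι → Set α)
    (hS : ∀ y, (S y).Nonempty) (f : ι → α → ℝ≥0∞) {B : ℝ≥0∞}
    (h : ∀ v : ι → α, (∀ y, v y ∈ S y) → ∑ y ∈ Y, f y (v y) ^ 2 ≤ B) :
    ∑ y ∈ Y, (⨆ v ∈ S y, f y v) ^ 2 ≤ B := by
  have hu : ∀ y, ∃ u : ℕ → α, (∀ n, u n ∈ S y) ∧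
      Filter.Tendsto (fun n => f y (u n)) Filter.atTop (nhds (⨆ v ∈ S y, f y v)) := by
    intro y
    obtain ⟨u, -, hu, hm⟩ := exists_seq_tendsto_sSup ((hS y).image (f y)) (OrderTop.bddAbove _)
    choose w hw hwu using hm
    rw [sSup_image] at hu
    exact ⟨w, hw, by simpa only [hwu] using hu⟩
  choose u hu hlim using hu
  refine le_of_tendsto' (tendsto_finsetSum Y fun y _ => (ENNReal.continuous_pow 2).tendsto _
    |>.comp (hlim y)) fun n => h (fun y => u y n) fun y => hu y n

section
variable {d : ℕ} {Γ : Set (E (d + 1))}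

namespace Hhalf

variable (Γ) in
/-- The inclusion of `H^{1/2}(Γ)` into the space of all functions. -/
def incl : Hhalf Γ →ₗ[ℝ] (E (d + 1) → ℝ) := (HhalfSub Γ).subtype

theorem incl_apply (v : Hhalf Γ) : incl Γ v = v.1 := rfl

variable (Γ) in
/-- The difference quotient as a linear map. -/
def diffQuotₗ : Hhalf Γ →ₗ[ℝ] (E (d + 1) × E (d + 1) → ℝ) where
  toFun v := diffQuot v.1
  map_add' v w := diffQuot_add v.1 w.1
  map_smul' c v := diffQuot_smul c v.1

theorem diffQuotₗ_apply (v : Hhalf Γ) : diffQuotₗ Γ v = diffQuot v.1 := rfl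

theorem aestronglyMeasurable (v : Hhalf Γ) : AEStronglyMeasurable v.1 (surf Γ) := v.2.1.1

theorem l2Sq_nonneg (v : Hhalf Γ) : 0 ≤ l2Sq v := integral_nonneg fun _ => by positivity

theorem semiSq_eq (v : Hhalf Γ) :
    semiSq v = ∫ p, diffQuot v.1 p ^ 2 ∂((surf Γ).prod (surf Γ)) := by
  simp only [semiSq, diffQuot_sq]

theorem semiSq_nonneg (v : Hhalf Γ) : 0 ≤ semiSq v := integral_nonneg fun _ => by positivity

theorem ofReal_l2Sq (v : Hhalf Γ) : ENNReal.ofReal (l2Sq v) = ∫⁻ s, ‖v.1 s‖ₑ ^ 2 ∂(surf Γ) := by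
  simp only [l2Sq, sq_abs, enorm_sq_eq_ofReal]
  exact ofReal_integral_eq_lintegral_ofReal v.2.1.integrable_sq
    (Filter.Eventually.of_forall fun _ => sq_nonneg _)

theorem ofReal_semiSq (v : Hhalf Γ) :
    ENNReal.ofReal (semiSq v) = ∫⁻ p, ‖diffQuot v.1 p‖ₑ ^ 2 ∂((surf Γ).prod (surf Γ)) := by
  simp only [semiSq_eq, enorm_sq_eq_ofReal]
  exact ofReal_integral_eq_lintegral_ofReal v.2.2.integrable_sq
    (Filter.Eventually.of_forall fun _ => sq_nonneg _)

theorem norm_sq (v : Hhalf Γ) : ‖v‖ ^ 2 = l2Sq v + semiSq v := by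
  rw [norm_def, Real.sq_sqrt (add_nonneg (l2Sq_nonneg v) (semiSq_nonneg v))]

theorem sqrt_semiSq_le_norm (v : Hhalf Γ) : √(semiSq v) ≤ ‖v‖ :=
  Real.sqrt_le_sqrt (le_add_of_nonneg_left (l2Sq_nonneg v))

theorem semiSq_smul (c : ℝ) (v : Hhalf Γ) : semiSq (c • v) = c ^ 2 * semiSq v := by
  rw [semiSq_eq, semiSq_eq, ← integral_const_mul]
  congr 1 with p
  rw [← diffQuotₗ_apply, map_smul, Pi.smul_apply, diffQuotₗ_apply, smul_eq_mul, mul_pow]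

theorem norm_eq_zero_of_ae [SFinite (surf Γ)] {v : Hhalf Γ} (h : ∀ᵐ s ∂(surf Γ), v.1 s = 0) :
    ‖v‖ = 0 := by
  have h1 : l2Sq v = 0 := by
    refine integral_eq_zero_of_ae ?_
    filter_upwards [h] with s hs
    simp [hs]
  have h2 : semiSq v = 0 := by
    refine integral_eq_zero_of_ae ?_
    filter_upwards [Measure.quasiMeasurePreserving_fst.ae h,
      Measure.quasiMeasurePreserving_snd.ae h] with p hs ht
    simp [hs, ht]
  rw [norm_def, h1, h2]; simp

/-- Elements of `Hhalf Γ` are functions, not classes; continuity makes a functional blind to null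
sets. -/
theorem apply_eq_of_ae [SFinite (surf Γ)] (ξ : HmHalf Γ) {v w : Hhalf Γ}
    (h : ∀ᵐ s ∂(surf Γ), v.1 s = w.1 s) : ξ v = ξ w := by
  have h0 : ‖v - w‖ = 0 := norm_eq_zero_of_ae <| by
    filter_upwards [h] with s hs
    change incl Γ (v - w) s = 0
    rw [map_sub, Pi.sub_apply, incl_apply, incl_apply, hs, sub_self]
  have := ξ.le_opNorm (v - w)
  rw [h0, mul_zero, norm_le_zero_iff, map_sub, sub_eq_zero] at this
  exact this

/-- The constant functions. -/
def const (Γ : Set (E (d + 1))) [IsFiniteMeasure (surf Γ)] (a : ℝ) : Hhalf Γ :=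
  ⟨fun _ => a, memLp_const a, by
    have : diffQuot (fun _ : E (d + 1) => a) = 0 := by funext p; simp [diffQuot]
    rw [this]; exact MemLp.zero⟩

theorem diffQuot_sub_const (v : E (d + 1) → ℝ) (a : ℝ) :
    diffQuot (fun s => v s - a) = diffQuot v := by
  funext p; simp [diffQuot]

theorem coe_sub_const [IsFiniteMeasure (surf Γ)] (v : Hhalf Γ) (a : ℝ) :
    (v - const Γ a).1 = fun s => v.1 s - a := rfl

theorem semiSq_sub_const [IsFiniteMeasure (surf Γ)] (v : Hhalf Γ) (a : ℝ) :
    semiSq (v - const Γ a) = semiSq v := by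
  rw [semiSq_eq, semiSq_eq, coe_sub_const, diffQuot_sub_const]

/-- The Poincaré inequality on `Γ`. -/
theorem exists_l2Sq_sub_const_le [IsFiniteMeasure (surf Γ)] (hΓ : IsCompact Γ)
    (h0 : surf Γ Γ ≠ 0) :
    ∃ K : ℝ, 0 ≤ K ∧ ∀ v : Hhalf Γ, ∃ a, l2Sq (v - const Γ a) ≤ K * semiSq v := by
  have hfin : ENNReal.ofReal (Metric.diam Γ ^ (d + 1)) / surf Γ Γ ≠ ∞ :=
    ENNReal.div_ne_top ENNReal.ofReal_ne_top h0
  refine ⟨_, ENNReal.toReal_nonneg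
    (a := ENNReal.ofReal (Metric.diam Γ ^ (d + 1)) / surf Γ Γ), fun v => ?_⟩
  obtain ⟨a, ha⟩ := exists_const_lintegral_sub_sq_le v.aestronglyMeasurable
    hΓ.isClosed.measurableSet fun s hs t ht => Metric.dist_le_diam_of_mem hΓ.isBounded hs ht
  have hr : (surf Γ).restrict Γ = surf Γ := by
    rw [surf, Measure.restrict_restrict hΓ.isClosed.measurableSet, inter_self]
  refine ⟨a, ?_⟩
  rw [← ENNReal.ofReal_le_ofReal_iff (mul_nonneg ENNReal.toReal_nonneg (semiSq_nonneg v)),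
    ENNReal.ofReal_mul ENNReal.toReal_nonneg, ENNReal.ofReal_toReal hfin, ofReal_l2Sq,
    ofReal_semiSq]
  rw [hr, ← Measure.prod_restrict, hr] at ha
  exact ha

/-- Functionals that vanish on the constants are bounded by the seminorm. -/
theorem abs_apply_le [IsFiniteMeasure (surf Γ)] {K : ℝ} (hK : 0 ≤ K)
    (hP : ∀ v : Hhalf Γ, ∃ a, l2Sq (v - const Γ a) ≤ K * semiSq v) {ξ : HmHalf Γ}
    (hξ : ∀ a, ξ (const Γ a) = 0) (v : Hhalf Γ) : |ξ v| ≤ ‖ξ‖ * √(K + 1) * √(semiSq v) := by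
  obtain ⟨a, ha⟩ := hP v
  have h1 : ξ v = ξ (v - const Γ a) := by rw [map_sub, hξ, sub_zero]
  rw [h1, mul_assoc, ← Real.sqrt_mul (by positivity)]
  refine (ξ.le_opNorm _).trans ?_
  gcongr
  apply Real.le_sqrt_of_sq_le
  rw [norm_sq, semiSq_sub_const]
  linarith

end Hhalf

/-! ### Localized dual norms and bounded overlap -/

open Hhalf

theorem mem_HhalfZZ {ω : Set (E (d + 1))} {v : Hhalf Γ} :
    v ∈ HhalfZZ ω ↔ ∀ᵐ s ∂(surf Γ), s ∉ ω → v.1 s = 0 := Iff.rfl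

theorem HhalfZZ_nonempty (ω : Set (E (d + 1))) : (HhalfZZ ω : Set (Hhalf Γ)).Nonempty :=
  ⟨0, mem_HhalfZZ.2 (Filter.Eventually.of_forall fun _ _ => rfl)⟩

theorem smul_mem_HhalfZZ {ω : Set (E (d + 1))} {v : Hhalf Γ} (hv : v ∈ HhalfZZ ω) (c : ℝ) :
    c • v ∈ HhalfZZ ω := by
  rw [mem_HhalfZZ] at hv ⊢
  filter_upwards [hv] with s hs h
  change c • incl Γ v s = 0
  rw [incl_apply, hs h, smul_zero]

open Classical in
/-- The seminorm of a sum of functions whose supports have bounded overlap. -/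
theorem semiSq_sum_le [SFinite (surf Γ)] {ι : Type*} (Y : Finset ι) (ω : ι → Set (E (d + 1)))
    {N : ℕ} (hN : ∀ s, (Y.filter fun y => s ∈ ω y).card ≤ N) (v : ι → Hhalf Γ)
    (hv : ∀ y, v y ∈ HhalfZZ (ω y)) :
    semiSq (∑ y ∈ Y, v y) ≤ 2 * N * ∑ y ∈ Y, semiSq (v y) := by
  have hint : ∀ y, Integrable (fun p => diffQuot (v y).1 p ^ 2) ((surf Γ).prod (surf Γ)) :=
    fun y => (v y).2.2.integrable_sq
  simp only [semiSq_eq]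
  rw [← integral_finsetSum _ fun y _ => hint y, ← integral_const_mul]
  refine integral_mono_ae (∑ y ∈ Y, v y).2.2.integrable_sq
    ((integrable_finsetSum _ fun y _ => hint y).const_mul _) ?_
  have hall : ∀ᵐ s ∂(surf Γ), ∀ y ∈ Y, s ∉ ω y → (v y).1 s = 0 :=
    (ae_ball_iff Y.countable_toSet).2 fun y _ => mem_HhalfZZ.1 (hv y)
  filter_upwards [Measure.quasiMeasurePreserving_fst.ae hall,
    Measure.quasiMeasurePreserving_snd.ae hall] with p hs ht
  -- Only these at most 2N functions contribute to the difference quotient at p, so Cauchy–Schwarz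
  -- costs a factor 2N.
  set F := Y.filter fun y => p.1 ∈ ω y ∨ p.2 ∈ ω y with hF
  have hcard : F.card ≤ 2 * N := by
    rw [hF, Finset.filter_or]
    refine (Finset.card_union_le _ _).trans ?_
    linarith [hN p.1, hN p.2]
  have hsum : diffQuot (∑ y ∈ Y, v y).1 p = ∑ y ∈ F, diffQuot (v y).1 p := by
    rw [← diffQuotₗ_apply, map_sum, Finset.sum_apply]
    simp only [diffQuotₗ_apply]
    refine (Finset.sum_subset (Finset.filter_subset _ _) fun y hy hyF => ?_).symm
    simp only [Finset.mem_filter, not_and, not_or] at hyF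
    simp [diffQuot, hs y hy (hyF hy).1, ht y hy (hyF hy).2]
  simp only [hsum]
  calc _ ≤ (F.card : ℝ) * ∑ y ∈ F, diffQuot (v y).1 p ^ 2 := sq_sum_le_card_mul_sum_sq
    _ ≤ (2 * N) * ∑ y ∈ Y, diffQuot (v y).1 p ^ 2 := by
      gcongr
      · exact_mod_cast hcard
      · exact Finset.filter_subset _ _

/-- Testing ξ with the sum of suitably scaled local functions gives S = ∑ r_y² on the left and L √(B
S) on the right; dividing by √S bounds S. -/
theorem sum_tildeNorm_sq_le {ι : Type*} (Y : Finset ι) (ω : ι → Set (E (d + 1))) {ξ : HmHalf Γ}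
    {L B : ℝ} (hB : 0 ≤ B) (hξ : ∀ v, |ξ v| ≤ L * √(semiSq v))
    (hsum : ∀ v : ι → Hhalf Γ, (∀ y, v y ∈ HhalfZZ (ω y)) →
      semiSq (∑ y ∈ Y, v y) ≤ B * ∑ y ∈ Y, semiSq (v y)) :
    ∑ y ∈ Y, tildeNorm (ω y) ξ ^ 2 ≤ ENNReal.ofReal (L ^ 2 * B) := by
  refine sum_biSup_sq_le Y _ (fun y => HhalfZZ_nonempty (ω y))
    (fun _ v => ENNReal.ofReal (ξ v) / ENNReal.ofReal (√(semiSq v))) fun v hv => ?_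
  -- r is the local quotient, with negative values cut to zero as `ENNReal.ofReal` does; the scaling
  -- b makes both ξ(b v) and |b v|² equal to r². Where the seminorm vanishes, so does ξ, and 0 / 0 =
  -- 0 on both sides.
  set r : ι → ℝ := fun y => max (ξ (v y)) 0 / √(semiSq (v y)) with hr
  set b : ι → ℝ := fun y => r y / √(semiSq (v y)) with hb
  have hr0 : ∀ y, 0 ≤ r y := fun y => by positivity
  have hratio : ∀ y, ENNReal.ofReal (ξ (v y)) / ENNReal.ofReal (√(semiSq (v y))) =
      ENNReal.ofReal (r y) := by
    intro y
    rcases (Real.sqrt_nonneg (semiSq (v y))).eq_or_lt with h0 | h0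
    · have h1 := hξ (v y)
      rw [← h0, mul_zero] at h1
      have h2 : ξ (v y) = 0 := abs_nonpos_iff.1 h1
      simp [hr, h2]
    · rw [hr, ENNReal.ofReal_div_of_pos h0]
      congr 1
      rcases le_total (ξ (v y)) 0 with h | h
      · rw [max_eq_right h, ENNReal.ofReal_of_nonpos h, ENNReal.ofReal_zero]
      · rw [max_eq_left h]
  have hbr : ∀ y, semiSq (b y • v y) = r y ^ 2 ∧ b y * ξ (v y) = r y ^ 2 := by
    intro y
    rw [semiSq_smul]
    rcases (Real.sqrt_nonneg (semiSq (v y))).eq_or_lt with h0 | h0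
    · simp [hb, hr, ← h0]
    · have h1 : semiSq (v y) = √(semiSq (v y)) ^ 2 := (Real.sq_sqrt (semiSq_nonneg _)).symm
      constructor
      · rw [h1, ← mul_pow]
        simp only [hb]
        rw [div_mul_cancel₀ _ h0.ne']
      · simp only [hb, hr]
        rcases le_total (ξ (v y)) 0 with h | h
        · rw [max_eq_right h]; simp
        · rw [max_eq_left h]; ring
  simp only [hratio]
  rw [Finset.sum_congr rfl fun y _ => (ENNReal.ofReal_pow (hr0 y) 2).symm,
    ← ENNReal.ofReal_sum_of_nonneg fun y _ => sq_nonneg _]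
  apply ENNReal.ofReal_le_ofReal
  set S := ∑ y ∈ Y, r y ^ 2 with hS
  have hS0 : 0 ≤ S := Finset.sum_nonneg fun _ _ => sq_nonneg _
  have h1 : ξ (∑ y ∈ Y, b y • v y) = S := by
    rw [map_sum]
    exact Finset.sum_congr rfl fun y _ => by rw [map_smul, smul_eq_mul, (hbr y).2]
  have h2 : semiSq (∑ y ∈ Y, b y • v y) ≤ B * S := by
    refine (hsum _ fun y => smul_mem_HhalfZZ (hv y) _).trans_eq ?_
    rw [Finset.sum_congr rfl fun y _ => (hbr y).1]
  have h3 := hξ (∑ y ∈ Y, b y • v y)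
  rw [h1, abs_of_nonneg hS0] at h3
  rcases hS0.eq_or_lt with h0 | h0
  · rw [← h0]; positivity
  have h4 : S ^ 2 ≤ L ^ 2 * B * S := by
    calc S ^ 2 ≤ (L * √(semiSq (∑ y ∈ Y, b y • v y))) ^ 2 := by gcongr
      _ = L ^ 2 * semiSq (∑ y ∈ Y, b y • v y) := by
        rw [mul_pow, Real.sq_sqrt (semiSq_nonneg _)]
      _ ≤ L ^ 2 * (B * S) := by gcongr
      _ = _ := by ring
  rw [sq] at h4
  exact le_of_mul_le_mul_right h4 h0

/-- Finiteness excludes a positive value of ξ on a function with vanishing seminorm, which would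
make the supremum infinite. -/
theorem apply_le_tildeNorm {ω : Set (E (d + 1))} {ξ : HmHalf Γ} (hfin : tildeNorm ω ξ ≠ ∞)
    {u : Hhalf Γ} (hu : u ∈ HhalfZZ ω) : ξ u ≤ (tildeNorm ω ξ).toReal * √(semiSq u) := by
  have h : ENNReal.ofReal (ξ u) / ENNReal.ofReal (√(semiSq u)) ≤ tildeNorm ω ξ :=
    le_biSup (fun u : Hhalf Γ => ENNReal.ofReal (ξ u) / ENNReal.ofReal (√(semiSq u))) hu
  rw [ENNReal.div_le_iff_le_mul (Or.inr hfin) (Or.inl ENNReal.ofReal_ne_top)] at h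
  rw [← ENNReal.ofReal_toReal hfin, ← ENNReal.ofReal_mul ENNReal.toReal_nonneg] at h
  exact (ENNReal.ofReal_le_ofReal_iff (by positivity)).1 h

/-- If every `v` splits, as far as `ξ` can see, into functions on the patches, then the norm of `ξ`
is bounded by its localized norms. -/
theorem norm_sq_le_sum_tildeNorm {ι : Type*} (Y : Finset ι) (ω : ι → Set (E (d + 1)))
    {ξ : HmHalf Γ} {B : ℝ} (hB : 0 ≤ B) (hfin : ∀ y ∈ Y, tildeNorm (ω y) ξ ≠ ∞)
    (h : ∀ v : Hhalf Γ, ∃ u : ι → Hhalf Γ, (∀ y ∈ Y, u y ∈ HhalfZZ (ω y)) ∧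
      ξ v = ∑ y ∈ Y, ξ (u y) ∧ ∑ y ∈ Y, semiSq (u y) ≤ B * semiSq v) :
    ‖ξ‖ ^ 2 ≤ B * ∑ y ∈ Y, (tildeNorm (ω y) ξ).toReal ^ 2 := by
  set S := ∑ y ∈ Y, (tildeNorm (ω y) ξ).toReal ^ 2 with hS
  have hS0 : 0 ≤ S := Finset.sum_nonneg fun _ _ => sq_nonneg _
  have key : ∀ v : Hhalf Γ, ξ v ≤ √(B * S) * ‖v‖ := by
    intro v
    obtain ⟨u, hu, huv, hsum⟩ := h v
    calc ξ v ≤ ∑ y ∈ Y, (tildeNorm (ω y) ξ).toReal * √(semiSq (u y)) := by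
          rw [huv]
          exact Finset.sum_le_sum fun y hy => apply_le_tildeNorm (hfin y hy) (hu y hy)
      _ ≤ √S * √(∑ y ∈ Y, √(semiSq (u y)) ^ 2) := Real.sum_mul_le_sqrt_mul_sqrt _ _ _
      _ ≤ √S * √(B * semiSq v) := by
          simp only [Real.sq_sqrt (semiSq_nonneg _)]
          gcongr
      _ = √(B * S) * √(semiSq v) := by
          rw [Real.sqrt_mul hB, Real.sqrt_mul hB]; ring
      _ ≤ _ := by gcongr; exact sqrt_semiSq_le_norm v
  have hn : ‖ξ‖ ≤ √(B * S) := by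
    refine ξ.opNorm_le_bound (Real.sqrt_nonneg _) fun v => ?_
    rw [Real.norm_eq_abs, abs_le']
    refine ⟨key v, ?_⟩
    have := key (-v)
    rwa [map_neg, norm_neg] at this
  calc ‖ξ‖ ^ 2 ≤ √(B * S) ^ 2 := by gcongr
    _ = B * S := Real.sq_sqrt (by positivity)

end

/-! ### Stability of the cut-off by the partition of unity -/

section
variable {d : ℕ} {Γ : Set (E (d + 1))}

theorem abs_le_of_supNorm_le {ω : Set (E (d + 1))} {φ : E (d + 1) → ℝ} {c : ℝ}
    (h0 : ∀ s ∈ Γ, s ∉ ω → φ s = 0) (h : supNorm ω φ ≤ ENNReal.ofReal c) {s : E (d + 1)}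
    (hs : s ∈ Γ) : |φ s| ≤ max c 0 := by
  by_cases hsω : s ∈ ω
  · have h1 : ‖φ s‖ₑ ≤ ENNReal.ofReal c := (le_biSup (fun s => ‖φ s‖ₑ) hsω).trans h
    rw [Real.enorm_eq_ofReal_abs] at h1
    exact (ENNReal.ofReal_le_ofReal_iff (le_max_right _ _)).1
      (h1.trans (ENNReal.ofReal_le_ofReal (le_max_left _ _)))
  · rw [h0 s hs hsω, abs_zero]; exact le_max_right _ _

/-- The comparison of distances is needed twice: to replace the geodesic distance by the Euclidean
one, and to make it finite, since a quotient by ∞ is 0 and carries no information. -/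
theorem abs_sub_le_of_lipSeminorm_le {φ : E (d + 1) → ℝ} {L : ℝ} {K : ℝ≥0} (hL : 0 ≤ L)
    (hK : ∀ s ∈ Γ, ∀ t ∈ Γ, geodesicEDist Γ s t ≤ K * edist s t)
    (h : lipSeminorm Γ φ ≤ ENNReal.ofReal L) {s t : E (d + 1)} (hs : s ∈ Γ) (ht : t ∈ Γ) :
    |φ s - φ t| ≤ L * (K * dist s t) := by
  have hg := hK s hs t ht
  have h1 : edist (φ s) (φ t) / geodesicEDist Γ s t ≤ ENNReal.ofReal L :=
    ((le_biSup (fun t => edist (φ s) (φ t) / geodesicEDist Γ s t) ht).trans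
      (le_biSup (fun s => ⨆ t ∈ Γ, edist (φ s) (φ t) / geodesicEDist Γ s t) hs)).trans h
  have hgt : geodesicEDist Γ s t ≠ ∞ :=
    (hg.trans_lt (ENNReal.mul_lt_top ENNReal.coe_lt_top (edist_lt_top _ _))).ne
  rw [ENNReal.div_le_iff_le_mul (Or.inr ENNReal.ofReal_ne_top) (Or.inl hgt)] at h1
  have h2 : edist (φ s) (φ t) ≤ ENNReal.ofReal L * (K * edist s t) := h1.trans (by gcongr)
  rw [edist_dist, edist_dist, ← ENNReal.ofReal_coe_nnreal, ← ENNReal.ofReal_mul K.coe_nonneg,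
    ← ENNReal.ofReal_mul hL] at h2
  exact (ENNReal.ofReal_le_ofReal_iff (by positivity)).1 h2

theorem ae_mem_surf (hΓ : IsClosed Γ) : ∀ᵐ s ∂(surf Γ), s ∈ Γ :=
  ae_restrict_mem hΓ.measurableSet

theorem lintegral_diffQuot_left_le (hΓ : IsClosed Γ) {φ : E (d + 1) → ℝ} {c h : ℝ} {B : ℝ≥0∞}
    (hφ : ∀ s ∈ Γ, ∀ t ∈ Γ, |φ s - φ t| ≤ c * min 1 (dist s t / h))
    (hB : ∀ s, ∫⁻ t, ENNReal.ofReal (min 1 (dist s t / h) ^ 2 / dist s t ^ (d + 1)) ∂(surf Γ)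
      ≤ B) {s : E (d + 1)} (hs : s ∈ Γ) :
    ∫⁻ t, ‖diffQuot φ (s, t)‖ₑ ^ 2 ∂(surf Γ) ≤ ENNReal.ofReal (c ^ 2) * B := by
  calc _ ≤ ∫⁻ t, ENNReal.ofReal (c ^ 2) *
        ENNReal.ofReal (min 1 (dist s t / h) ^ 2 / dist s t ^ (d + 1)) ∂(surf Γ) := by
        refine lintegral_mono_ae ?_
        filter_upwards [ae_mem_surf hΓ] with t ht
        rw [enorm_diffQuot_sq, ← ENNReal.ofReal_mul (sq_nonneg _)]
        apply ENNReal.ofReal_le_ofReal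
        rw [mul_div_assoc', ← mul_pow, ← sq_abs]
        gcongr
        exact hφ s hs t ht
    _ = ENNReal.ofReal (c ^ 2) *
        ∫⁻ t, ENNReal.ofReal (min 1 (dist s t / h) ^ 2 / dist s t ^ (d + 1)) ∂(surf Γ) :=
        lintegral_const_mul' _ _ ENNReal.ofReal_ne_top
    _ ≤ _ := by gcongr; exact hB s

/-- Multiplication by a cut-off function maps into `H^{1/2}_{00}(ω)`. -/
theorem exists_cutoff [IsFiniteMeasure (surf Γ)] (hΓ : IsClosed Γ) {φ : Hhalf Γ}
    {ω : Set (E (d + 1))} (hω : MeasurableSet ω) (hφ0 : ∀ s ∈ Γ, s ∉ ω → φ.1 s = 0) {c : ℝ}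
    (hφc : ∀ s ∈ Γ, |φ.1 s| ≤ c) {B : ℝ≥0∞} (hBfin : B ≠ ∞)
    (hB : ∀ s ∈ Γ, ∫⁻ t, ‖diffQuot φ.1 (s, t)‖ₑ ^ 2 ∂(surf Γ) ≤ B) (v : Hhalf Γ) (a : ℝ) :
    ∃ u : Hhalf Γ, u ∈ HhalfZZ ω ∧ (∀ s, u.1 s = φ.1 s * (v.1 s - a)) ∧
      ENNReal.ofReal (semiSq u) ≤ 2 * ENNReal.ofReal (c ^ 2) *
        ∫⁻ p in ω ×ˢ ω, ‖diffQuot v.1 p‖ₑ ^ 2 ∂((surf Γ).prod (surf Γ)) +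
        4 * B * ∫⁻ s in ω, ‖v.1 s - a‖ₑ ^ 2 ∂(surf Γ) := by
  set w : Hhalf Γ := v - Hhalf.const Γ a with hw
  have hwm := w.aestronglyMeasurable
  have hl : ∫⁻ s, ‖w.1 s‖ₑ ^ 2 ∂(surf Γ) ≠ ∞ := by
    rw [← Hhalf.ofReal_l2Sq]; exact ENNReal.ofReal_ne_top
  have hs : ∫⁻ p, ‖diffQuot w.1 p‖ₑ ^ 2 ∂((surf Γ).prod (surf Γ)) ≠ ∞ := by
    rw [← Hhalf.ofReal_semiSq]; exact ENNReal.ofReal_ne_top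
  have hmul := lintegral_diffQuot_mul_le (ae_mem_surf hΓ) hω φ.aestronglyMeasurable hwm hφ0 hφc hB
  have hm := φ.aestronglyMeasurable.mul hwm
  have h1 : MemLp (φ.1 * w.1) 2 (surf Γ) := by
    rw [memLp_two_iff hm]
    calc _ ≤ ∫⁻ s, ENNReal.ofReal (c ^ 2) * ‖w.1 s‖ₑ ^ 2 ∂(surf Γ) := by
          refine lintegral_mono_ae ?_
          filter_upwards [ae_mem_surf hΓ] with s hs
          rw [Pi.mul_apply, enorm_mul, mul_pow, enorm_sq_eq_ofReal (φ.1 s), ← sq_abs]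
          gcongr
          exact hφc s hs
      _ = ENNReal.ofReal (c ^ 2) * ∫⁻ s, ‖w.1 s‖ₑ ^ 2 ∂(surf Γ) :=
          lintegral_const_mul' _ _ ENNReal.ofReal_ne_top
      _ < ∞ := by finiteness
  have h2 : MemLp (diffQuot (φ.1 * w.1)) 2 ((surf Γ).prod (surf Γ)) := by
    rw [memLp_two_iff (aestronglyMeasurable_diffQuot hm)]
    refine hmul.trans_lt ?_
    have h3 : ∫⁻ p in ω ×ˢ ω, ‖diffQuot w.1 p‖ₑ ^ 2 ∂((surf Γ).prod (surf Γ)) ≠ ∞ :=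
      ne_top_of_le_ne_top hs (setLIntegral_le_lintegral _ _)
    have h4 : ∫⁻ s in ω, ‖w.1 s‖ₑ ^ 2 ∂(surf Γ) ≠ ∞ :=
      ne_top_of_le_ne_top hl (setLIntegral_le_lintegral _ _)
    finiteness
  obtain ⟨u, hu⟩ : ∃ u : Hhalf Γ, u.1 = φ.1 * w.1 := ⟨⟨φ.1 * w.1, h1, h2⟩, rfl⟩
  refine ⟨u, ?_, fun s => by rw [hu]; rfl, ?_⟩
  · rw [mem_HhalfZZ]
    filter_upwards [ae_mem_surf hΓ] with s hs hsω
    rw [hu, Pi.mul_apply, hφ0 s hs hsω, zero_mul]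
  · rw [Hhalf.ofReal_semiSq, hu]
    have e : diffQuot w.1 = diffQuot v.1 := Hhalf.diffQuot_sub_const v.1 a
    rw [e] at hmul
    exact hmul

/-- The Poincaré inequality on the patches. -/
theorem Mesh.exists_patch_poincare [IsFiniteMeasure (surf Γ)] (hd : 1 ≤ d) {κ : ℝ} (hκ : 0 < κ) :
    ∃ G : ℝ≥0, ∀ T : Mesh Γ, T.ShapeRegular κ → T.QuasiUniform κ → ∀ y, ∀ v : Hhalf Γ, ∃ a : ℝ,
      ∫⁻ s in T.patch y, ‖v.1 s - a‖ₑ ^ 2 ∂(surf Γ) ≤ G * ENNReal.ofReal T.meshSize *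
        ∫⁻ p in T.patch y ×ˢ T.patch y, ‖diffQuot v.1 p‖ₑ ^ 2 ∂((surf Γ).prod (surf Γ)) := by
  have hV0 := volume_refSimplex_ne_zero d
  have hV : volume (refSimplex d) ≠ ∞ := (isCompact_refSimplex d).measure_ne_top
  have hG : ENNReal.ofReal (2 ^ (d + 1)) * ENNReal.ofReal ((κ ^ 2) ^ d) *
      (volume (refSimplex d))⁻¹ ≠ ∞ := by finiteness
  refine ⟨(ENNReal.ofReal (2 ^ (d + 1)) * ENNReal.ofReal ((κ ^ 2) ^ d) *
    (volume (refSimplex d))⁻¹).toNNReal, fun T hT hQ y v => ?_⟩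
  rw [ENNReal.coe_toNNReal hG]
  rcases (T.patch y).eq_empty_or_nonempty with h0 | hne
  · exact ⟨0, by simp [h0]⟩
  obtain ⟨a, ha⟩ := exists_const_lintegral_sub_sq_le v.aestronglyMeasurable
    (T.measurableSet_patch y) fun s hs t ht => T.dist_le_of_mem_patch hs ht
  refine ⟨a, ha.trans ?_⟩
  gcongr
  have hm : 0 ≤ T.meshSize := Real.iSup_nonneg fun _ => Metric.diam_nonneg
  -- With diameter at most 2h and measure ≳ h^d, the Poincaré factor (2h)^(d+1) / surf(ω_y) is of
  -- order h.
  apply ENNReal.div_le_of_le_mul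
  have h1 := hT.le_surf_patch hd hκ hQ hne
  rw [← ENNReal.le_div_iff_mul_le (Or.inl hV0) (Or.inl hV), div_eq_mul_inv] at h1
  calc ENNReal.ofReal ((2 * T.meshSize) ^ (d + 1))
      = ENNReal.ofReal (2 ^ (d + 1)) * ENNReal.ofReal T.meshSize *
          ENNReal.ofReal (T.meshSize ^ d) := by
        rw [← ENNReal.ofReal_mul (by positivity), ← ENNReal.ofReal_mul (by positivity)]
        congr 1; ring
    _ ≤ ENNReal.ofReal (2 ^ (d + 1)) * ENNReal.ofReal T.meshSize *
          (ENNReal.ofReal ((κ ^ 2) ^ d) * surf Γ (T.patch y) * (volume (refSimplex d))⁻¹) := by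
        gcongr
    _ = _ := by ring

open Classical in
-- A pair lies in ω_y × ω_y only if its first point lies in ω_y, which happens for at most N
-- indices.
theorem sum_setLIntegral_prod_le {ι : Type*} (Y : Finset ι) (ω : ι → Set (E (d + 1)))
    (hω : ∀ y, MeasurableSet (ω y)) {N : ℕ}
    (hN : ∀ s, (Y.filter fun y => s ∈ ω y).card ≤ N) {μ : Measure (E (d + 1) × E (d + 1))}
    {f : E (d + 1) × E (d + 1) → ℝ≥0∞} (hf : AEMeasurable f μ) :
    ∑ y ∈ Y, ∫⁻ p in ω y ×ˢ ω y, f p ∂μ ≤ N * ∫⁻ p, f p ∂μ := by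
  simp only [← lintegral_indicator ((hω _).prod (hω _))]
  rw [← lintegral_finsetSum' _ fun y _ => hf.indicator ((hω y).prod (hω y)),
    ← lintegral_const_mul'' _ hf]
  refine lintegral_mono fun p => ?_
  calc ∑ y ∈ Y, (ω y ×ˢ ω y).indicator f p ≤ ∑ y ∈ Y, if p.1 ∈ ω y then f p else 0 := by
        refine Finset.sum_le_sum fun y _ => ?_
        by_cases h : p ∈ ω y ×ˢ ω y
        · rw [indicator_of_mem h, if_pos h.1]
        · rw [indicator_of_notMem h]; exact zero_le
    _ = (Y.filter fun y => p.1 ∈ ω y).card * f p := by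
        rw [← Finset.sum_filter, Finset.sum_const, nsmul_eq_mul]
    _ ≤ _ := by gcongr; exact hN p.1

theorem frontier_nonempty_of_isAdmissibleDomain {Ω : Set (E (d + 1))}
    (hΩ : IsAdmissibleDomain Ω) : (frontier Ω).Nonempty := by
  rw [nonempty_iff_ne_empty]
  intro h
  rcases isClopen_iff.1 (isClopen_iff_frontier_eq_empty.2 h) with h | h
  · exact hΩ.simplyConnected.nonempty.ne_empty h
  · exact NormedSpace.unbounded_univ ℝ (E (d + 1)) (h ▸ hΩ.isBounded)

theorem Mesh.surf_ne_zero {T : Mesh Γ} {κ : ℝ} (hd : 1 ≤ d) (hκ : 0 < κ) (hT : T.ShapeRegular κ)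
    (i : Fin T.card) : surf Γ Γ ≠ 0 := by
  intro h
  have h1 := hT.volume_le hd hκ i
  rw [measure_mono_null (T.elem_subset i) h, mul_zero, nonpos_iff_eq_zero] at h1
  exact volume_refSimplex_ne_zero d h1

/-- Cut-off by the partition of unity, after subtraction of suitable constants, is stable in
`H^{1/2}(Γ)`, uniformly in the mesh. -/
theorem exists_partition_bound [IsFiniteMeasure (surf Γ)] (hd : 1 ≤ d) (hΓ : IsClosed Γ)
    {κ : ℝ} (hκ : 0 < κ) (c : ℝ) {K : ℝ≥0}
    (hK : ∀ s ∈ Γ, ∀ t ∈ Γ, geodesicEDist Γ s t ≤ K * edist s t) {A : ℝ≥0}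
    (hA : ∀ x r, 0 ≤ r → surf Γ (Metric.closedBall x r) ≤ A * ENNReal.ofReal (r ^ d)) :
    ∃ Q : ℝ≥0, ∀ T : Mesh Γ, T.ShapeRegular κ → T.QuasiUniform κ → 0 < T.meshSize → ∀ y,
      ∀ φ : Hhalf Γ, (∀ s ∈ Γ, s ∉ T.patch y → φ.1 s = 0) →
      supNorm (T.patch y) φ.1 ≤ ENNReal.ofReal c →
      lipSeminorm Γ φ.1 ≤ ENNReal.ofReal (c / T.meshSize) → ∀ v : Hhalf Γ,
      ∃ (a : ℝ) (u : Hhalf Γ), u ∈ HhalfZZ (T.patch y) ∧ (∀ s, u.1 s = φ.1 s * (v.1 s - a)) ∧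
        ENNReal.ofReal (semiSq u) ≤ Q *
          ∫⁻ p in T.patch y ×ˢ T.patch y, ‖diffQuot v.1 p‖ₑ ^ 2 ∂((surf Γ).prod (surf Γ)) := by
  obtain ⟨Ck, hCk⟩ := exists_lintegral_kernel_le d A
  obtain ⟨G, hG⟩ := Mesh.exists_patch_poincare (Γ := Γ) hd hκ
  -- The sign of c is not prescribed, hence c₀. In c₁ the 2 comes from |φ s| + |φ t|, and K from the
  -- passage to Euclidean distance.
  set c₀ := max c 0 with hc₀
  set c₁ := c₀ * max 2 K with hc₁
  have hc₀0 : 0 ≤ c₀ := le_max_right _ _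
  refine ⟨2 * Real.toNNReal (c₀ ^ 2) + 4 * Real.toNNReal (c₁ ^ 2) * Ck * G,
    fun T hT hQ hh y φ h0 hsup hlip v => ?_⟩
  set h := T.meshSize with hh_def
  have hφc : ∀ s ∈ Γ, |φ.1 s| ≤ c₀ := fun s hs => abs_le_of_supNorm_le h0 hsup hs
  have hlip' : lipSeminorm Γ φ.1 ≤ ENNReal.ofReal (c₀ / h) := by
    refine hlip.trans (ENNReal.ofReal_le_ofReal ?_)
    gcongr
    exact le_max_left _ _
  have hφ : ∀ s ∈ Γ, ∀ t ∈ Γ, |φ.1 s - φ.1 t| ≤ c₁ * min 1 (dist s t / h) := by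
    intro s hs t ht
    rw [mul_min_of_nonneg _ _ (by positivity), le_min_iff]
    constructor
    · calc |φ.1 s - φ.1 t| ≤ |φ.1 s| + |φ.1 t| := abs_sub _ _
        _ ≤ c₀ * 2 := by linarith [hφc s hs, hφc t ht]
        _ ≤ c₁ * 1 := by
          rw [mul_one, hc₁]; exact mul_le_mul_of_nonneg_left (le_max_left _ _) hc₀0
    · calc |φ.1 s - φ.1 t| ≤ c₀ / h * (K * dist s t) :=
          abs_sub_le_of_lipSeminorm_le (by positivity) hK hlip' hs ht
        _ = c₀ * K * (dist s t / h) := by ring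
        _ ≤ _ := by
          rw [hc₁]
          gcongr
          exact le_max_right _ _
  have hB : ∀ s ∈ Γ, ∫⁻ t, ‖diffQuot φ.1 (s, t)‖ₑ ^ 2 ∂(surf Γ) ≤
      ENNReal.ofReal (c₁ ^ 2) * (Ck * ENNReal.ofReal h⁻¹) := fun s hs =>
    lintegral_diffQuot_left_le hΓ hφ (hCk _ hA h hh) hs
  obtain ⟨a, ha⟩ := hG T hT hQ y v
  obtain ⟨u, hu, hus, hsemi⟩ := exists_cutoff hΓ (T.measurableSet_patch y) h0 hφc
    (by finiteness) hB v a
  refine ⟨a, u, hu, hus, hsemi.trans ?_⟩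
  set J := ∫⁻ p in T.patch y ×ˢ T.patch y, ‖diffQuot v.1 p‖ₑ ^ 2 ∂((surf Γ).prod (surf Γ))
  -- The 1/h of the kernel integral meets the h of the patch Poincaré inequality; this makes the
  -- bound independent of the mesh size.
  have hcancel : ENNReal.ofReal h⁻¹ * ENNReal.ofReal h = 1 := by
    rw [← ENNReal.ofReal_mul (by positivity), inv_mul_cancel₀ hh.ne', ENNReal.ofReal_one]
  calc _ ≤ 2 * ENNReal.ofReal (c₀ ^ 2) * J +
        4 * (ENNReal.ofReal (c₁ ^ 2) * (Ck * ENNReal.ofReal h⁻¹)) *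
          (G * ENNReal.ofReal h * J) := by gcongr
    _ = 2 * ENNReal.ofReal (c₀ ^ 2) * J +
        4 * ENNReal.ofReal (c₁ ^ 2) * Ck * G * J *
          (ENNReal.ofReal h⁻¹ * ENNReal.ofReal h) := by ring
    _ = _ := by
        rw [hcancel]
        push_cast
        simp only [ENNReal.ofReal]
        ring

end

/-! ### Use of the orthogonality, and combination of the two bounds -/

section
variable {d : ℕ} {Γ : Set (E (d + 1))} [IsFiniteMeasure (surf Γ)] {ι : Type*}

/-- Functionals that annihilate a partition of unity annihilate the constants. -/
theorem apply_const_eq_zero (hΓ : IsClosed Γ) {Y : Finset ι} {φ : ι → Hhalf Γ}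
    (hφ : ∀ s ∈ Γ, ∑ y ∈ Y, (φ y).1 s = 1) {ξ : HmHalf Γ} (hξ : ∀ y ∈ Y, ξ (φ y) = 0) (a : ℝ) :
    ξ (Hhalf.const Γ a) = 0 := by
  have h : ξ (Hhalf.const Γ a) = ξ (∑ y ∈ Y, a • φ y) := by
    refine Hhalf.apply_eq_of_ae ξ ?_
    filter_upwards [ae_mem_surf hΓ] with s hs
    rw [← Hhalf.incl_apply (∑ y ∈ Y, a • φ y), map_sum, Finset.sum_apply]
    simp only [map_smul, Pi.smul_apply, Hhalf.incl_apply, smul_eq_mul]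
    rw [← Finset.mul_sum, hφ s hs, mul_one]
    rfl
  rw [h, map_sum]
  exact Finset.sum_eq_zero fun y hy => by rw [map_smul, hξ y hy, smul_zero]

/-- On Γ, v is the sum of the u y + a y • φ y, and ξ annihilates the second terms. -/
theorem apply_eq_sum_cutoff (hΓ : IsClosed Γ) {Y : Finset ι} {φ : ι → Hhalf Γ}
    (hφ : ∀ s ∈ Γ, ∑ y ∈ Y, (φ y).1 s = 1) {ξ : HmHalf Γ} (hξ : ∀ y ∈ Y, ξ (φ y) = 0)
    {v : Hhalf Γ} {a : ι → ℝ} {u : ι → Hhalf Γ}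
    (hu : ∀ y ∈ Y, ∀ s, (u y).1 s = (φ y).1 s * (v.1 s - a y)) : ξ v = ∑ y ∈ Y, ξ (u y) := by
  have h : ξ v = ξ (∑ y ∈ Y, (u y + a y • φ y)) := by
    refine Hhalf.apply_eq_of_ae ξ ?_
    filter_upwards [ae_mem_surf hΓ] with s hs
    rw [← Hhalf.incl_apply (∑ y ∈ Y, (u y + a y • φ y)), map_sum, Finset.sum_apply]
    simp only [map_add, map_smul, Pi.add_apply, Pi.smul_apply, Hhalf.incl_apply, smul_eq_mul]
    calc v.1 s = (∑ y ∈ Y, (φ y).1 s) * v.1 s := by rw [hφ s hs, one_mul]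
      _ = _ := by
        rw [Finset.sum_mul]
        exact Finset.sum_congr rfl fun y hy => by rw [hu y hy]; ring
  rw [h, map_sum]
  exact Finset.sum_congr rfl fun y hy => by
    rw [map_add, map_smul, hξ y hy, smul_zero, add_zero]

end

/-- The combination of the localization estimates with the boundedness of the projector. -/
theorem localization_of_bounds {V ι : Type*} [SeminormedAddCommGroup V] {ζ ρ : V} {Y : Finset ι}
    {t : ι → ℝ≥0∞} {M B₁ B₂ : ℝ} (hM : 0 ≤ M) (hB₁ : 0 ≤ B₁) (hB₂ : 0 ≤ B₂)
    (hρ : ‖ρ‖ ≤ M * ‖ζ‖) (ht : ∀ y ∈ Y, t y ≠ ∞)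
    (hlow : ‖ζ - ρ‖ ^ 2 ≤ B₁ * ∑ y ∈ Y, (t y).toReal ^ 2)
    (hup : ∑ y ∈ Y, t y ^ 2 ≤ ENNReal.ofReal (‖ζ - ρ‖ ^ 2 * B₂)) :
    ‖ζ‖ₑ ^ 2 ≤ (2 + 2 * B₁ + M ^ 2 + (1 + M) ^ 2 * B₂).toNNReal *
        (‖ρ‖ₑ ^ 2 + ∑ y ∈ Y, t y ^ 2) ∧
      ‖ρ‖ₑ ^ 2 + ∑ y ∈ Y, t y ^ 2 ≤
        (2 + 2 * B₁ + M ^ 2 + (1 + M) ^ 2 * B₂).toNNReal * ‖ζ‖ₑ ^ 2 := by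
  set S := ∑ y ∈ Y, (t y).toReal ^ 2 with hS
  have hS0 : 0 ≤ S := Finset.sum_nonneg fun _ _ => sq_nonneg _
  have hSt : ∑ y ∈ Y, t y ^ 2 = ENNReal.ofReal S := by
    rw [hS, ENNReal.ofReal_sum_of_nonneg fun y _ => sq_nonneg _]
    refine Finset.sum_congr rfl fun y hy => ?_
    rw [ENNReal.ofReal_pow ENNReal.toReal_nonneg, ENNReal.ofReal_toReal (ht y hy)]
  have hx : ‖ζ - ρ‖ ≤ (1 + M) * ‖ζ‖ := by linarith [norm_sub_le ζ ρ]
  rw [hSt, ENNReal.ofReal_le_ofReal_iff (by positivity)] at hup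
  rw [hSt, ← ofReal_norm, ← ofReal_norm, ← ENNReal.ofReal_pow (norm_nonneg _),
    ← ENNReal.ofReal_pow (norm_nonneg _), ← ENNReal.ofReal_add (by positivity) hS0]
  change _ ≤ ENNReal.ofReal _ * _ ∧ _ ≤ ENNReal.ofReal _ * _
  rw [← ENNReal.ofReal_mul (by positivity), ← ENNReal.ofReal_mul (by positivity)]
  have hp2 : ‖ρ‖ ^ 2 ≤ M ^ 2 * ‖ζ‖ ^ 2 := by rw [← mul_pow]; gcongr
  have hx2 : ‖ζ - ρ‖ ^ 2 ≤ (1 + M) ^ 2 * ‖ζ‖ ^ 2 := by rw [← mul_pow]; gcongr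
  -- The lower estimate uses the part 2 + 2 B₁ of the constant, the upper one the rest; the other
  -- summands are nonnegative slack.
  constructor <;> apply ENNReal.ofReal_le_ofReal
  · have h1 : ‖ζ‖ ≤ ‖ρ‖ + ‖ζ - ρ‖ := norm_le_norm_add_norm_sub' ζ ρ
    have h2 : ‖ζ‖ ^ 2 ≤ 2 * ‖ρ‖ ^ 2 + 2 * ‖ζ - ρ‖ ^ 2 := by
      calc ‖ζ‖ ^ 2 ≤ (‖ρ‖ + ‖ζ - ρ‖) ^ 2 := by gcongr
        _ ≤ _ := by nlinarith [sq_nonneg (‖ρ‖ - ‖ζ - ρ‖)]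
    have h3 : 0 ≤ (2 * B₁ + M ^ 2 + (1 + M) ^ 2 * B₂) * ‖ρ‖ ^ 2 := by positivity
    have h4 : 0 ≤ (2 + M ^ 2 + (1 + M) ^ 2 * B₂) * S := by positivity
    linarith
  · have h3 : ‖ζ - ρ‖ ^ 2 * B₂ ≤ (1 + M) ^ 2 * ‖ζ‖ ^ 2 * B₂ := by gcongr
    have h4 : 0 ≤ (2 + 2 * B₁) * ‖ζ‖ ^ 2 := by positivity
    linarith

end TraceNorm

end

/-! ### Assembly of the constants -/

theorem mainTheorem4 (d : ℕ) (hd : d = 1 ∨ d = 2)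
    (Ω : Set (TraceNorm.E (d + 1))) (hΩ : TraceNorm.IsAdmissibleDomain Ω)
    (κ c M : ℝ) :
    ∃ C : ℝ≥0, ∀ T : TraceNorm.Mesh (frontier Ω), T.ShapeRegular κ → T.QuasiUniform κ →
      ∀ φ : TraceNorm.E (d + 1) → TraceNorm.Hhalf (frontier Ω),
      (∀ y ∈ T.nodes, TraceNorm.MemW1InfZero (frontier Ω) (T.patch y) (φ y)) →
      (∀ y ∈ T.nodes, TraceNorm.supNorm (T.patch y) (φ y) ≤ ENNReal.ofReal c) →
      (∀ y ∈ T.nodes,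
        TraceNorm.lipSeminorm (frontier Ω) (φ y) ≤ ENNReal.ofReal (c / T.meshSize)) →
      (∀ s ∈ frontier Ω, ∑ y ∈ T.nodes, φ y s = 1) →
      ∀ P : TraceNorm.HmHalf (frontier Ω) →L[ℝ] TraceNorm.HmHalf (frontier Ω),
      (∀ ζ, P (P ζ) = P ζ) → ‖P‖ ≤ M →
      (∀ ζ, ∀ y ∈ T.nodes, (ζ - P ζ) (φ y) = 0) →
      ∀ ζ : TraceNorm.HmHalf (frontier Ω),
        ‖ζ‖ₑ ^ 2 ≤ C * (‖P ζ‖ₑ ^ 2 +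
          ∑ y ∈ T.nodes, TraceNorm.tildeNorm (T.patch y) (ζ - P ζ) ^ 2) ∧
        ‖P ζ‖ₑ ^ 2 + ∑ y ∈ T.nodes, TraceNorm.tildeNorm (T.patch y) (ζ - P ζ) ^ 2
          ≤ C * ‖ζ‖ₑ ^ 2 := by
  classical
  have hd1 : 1 ≤ d := by omega
  -- Without an admissible mesh the claim is vacuous. Otherwise one mesh, fixed before T, supplies
  -- what is needed about Γ itself: compactness, positive finite measure and the growth bound A.
  by_cases hex : ∃ T : TraceNorm.Mesh (frontier Ω), T.ShapeRegular κ ∧ T.QuasiUniform κ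
  swap
  · exact ⟨0, fun T hT hQ => absurd ⟨T, hT, hQ⟩ hex⟩
  obtain ⟨T₀, hT₀, hQ₀⟩ := hex
  have hne := TraceNorm.frontier_nonempty_of_isAdmissibleDomain hΩ
  obtain ⟨i₀⟩ := T₀.nonempty_fin_card hne
  have hκ := T₀.kappa_pos hd1 hQ₀ i₀
  have hcpt := T₀.isCompact
  have hcl : IsClosed (frontier Ω) := isClosed_frontier
  obtain ⟨A, hA⟩ := hT₀.exists_surf_closedBall_le hd1 hκ
  have hfin := TraceNorm.Mesh.isFiniteMeasure_surf hcpt.isBounded hA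
  obtain ⟨K, hK⟩ := hΩ.nondegenerate
  obtain ⟨Q, hQ⟩ := TraceNorm.exists_partition_bound hd1 hcl hκ c hK hA
  obtain ⟨N, hN⟩ := TraceNorm.Mesh.ShapeRegular.exists_card_patch_le hd1 hκ A hA
  obtain ⟨Kp, hKp, hP⟩ := TraceNorm.Hhalf.exists_l2Sq_sub_const_le hcpt
    (TraceNorm.Mesh.surf_ne_zero hd1 hκ hT₀ i₀)
  -- Q * N combines cut-off stability with the overlap; (Kp + 1) * (2 * N) combines Poincaré on Γ
  -- with the overlap. M is replaced by max M 0, as its sign is unknown before P is given.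
  refine ⟨(2 + 2 * (Q * N) + (max M 0) ^ 2 + (1 + max M 0) ^ 2 * ((Kp + 1) * (2 * N))).toNNReal,
    fun T hT hQu φ hφ hsup hlip hsum P _ hPM horth ζ => ?_⟩
  obtain ⟨j⟩ := T.nonempty_fin_card hne
  have hh := T.meshSize_pos hd1 j
  set ξ := ζ - P ζ with hξ
  have hc0 := TraceNorm.apply_const_eq_zero hcl hsum (horth ζ)
  have hup : ∑ y ∈ T.nodes, TraceNorm.tildeNorm (T.patch y) ξ ^ 2 ≤
      ENNReal.ofReal (‖ξ‖ ^ 2 * ((Kp + 1) * (2 * N))) := by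
    refine (TraceNorm.sum_tildeNorm_sq_le T.nodes T.patch (by positivity)
      (TraceNorm.Hhalf.abs_apply_le hKp hP hc0)
      (TraceNorm.semiSq_sum_le T.nodes T.patch (hN T hT hQu))).trans_eq ?_
    rw [mul_pow, Real.sq_sqrt (by positivity), mul_assoc]
  -- The upper bound also yields finiteness of the local norms, which the lower bound presupposes.
  have htop : ∀ y ∈ T.nodes, TraceNorm.tildeNorm (T.patch y) ξ ≠ ∞ := by
    intro y hy h
    have h1 := (Finset.single_le_sum
      (f := fun y => TraceNorm.tildeNorm (T.patch y) ξ ^ 2) (fun _ _ => zero_le) hy).trans hup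
    rw [h, ENNReal.top_pow two_ne_zero, top_le_iff] at h1
    exact ENNReal.ofReal_ne_top h1
  refine TraceNorm.localization_of_bounds (le_max_right _ _) (by positivity) (by positivity)
    ?_ htop ?_ hup
  · exact (P.le_opNorm ζ).trans (by gcongr; exact hPM.trans (le_max_left _ _))
  · refine TraceNorm.norm_sq_le_sum_tildeNorm T.nodes T.patch (by positivity) htop fun v => ?_
    have hcut := fun y (hy : y ∈ T.nodes) =>
      hQ T hT hQu hh y (φ y) (hφ y hy).eq_zero (hsup y hy) (hlip y hy) v
    choose! a u hu hus hsemi using hcut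
    refine ⟨u, hu, TraceNorm.apply_eq_sum_cutoff hcl hsum (horth ζ) hus, ?_⟩
    rw [← ENNReal.ofReal_le_ofReal_iff
        (mul_nonneg (by positivity) (TraceNorm.Hhalf.semiSq_nonneg v)),
      ENNReal.ofReal_sum_of_nonneg fun y _ => TraceNorm.Hhalf.semiSq_nonneg (u y)]
    refine (Finset.sum_le_sum hsemi).trans ?_
    rw [← Finset.mul_sum, ENNReal.ofReal_mul (by positivity), ENNReal.ofReal_mul Q.coe_nonneg,
      ENNReal.ofReal_coe_nnreal, ENNReal.ofReal_natCast, mul_assoc, TraceNorm.Hhalf.ofReal_semiSq]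
    gcongr
    exact TraceNorm.sum_setLIntegral_prod_le T.nodes T.patch T.measurableSet_patch (hN T hT hQu)
      ((TraceNorm.aestronglyMeasurable_diffQuot v.aestronglyMeasurable).enorm.pow_const 2)
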